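/- Let $D\ge 3$ and $n\ge 0$ be integers. For a Lorentzian metric $g_{ab}$ in dimension $D$, let $R_{abcd}$, $R_{ab}$, $R$ be its Riemann tensor, Ricci tensor and Ricci scalar, with the conventions $R_{abc}{}^{d}=-2\partial_{[a}\Gamma_{b]c}{}^{d}+2\Gamma_{c[a}{}^{e}\Gamma_{b]e}{}^{d}$, $R_{ab}=R_{adb}{}^{d}$, $R=R_b{}^b$ (where $\Gamma_{ab}{}^{c}$ are the Christoffel symbols), let $Z_{ab}=R_{ab}-\tfrac1D g_{ab}R$, and put $$\mathcal K_2=\frac{1}{D(D-1)}Z_{ab}Z^{ab},\qquad \mathcal K_3=-\frac{1}{D(D-1)(D-2)}Z_{ab}Z^{bc}Z_c{}^{a}.$$ A curvature invariant of order $n$ is a complete contraction of $n$ copies of $R_{abcd}$ with $2n$ inverse metrics $g^{ab}$ (no covariant derivatives of the curvature and no parity-breaking terms). The FLRW metrics are $$\mathrm ds^2_{a,F}=-F(t)\,\mathrm dt^2+\frac{a(t)^2}{1-kr^2}\,\mathrm dr^2+a(t)^2r^2\,\mathrm d\Omega^2_{D-2},$$ where $k\in\{-1,0,1\}$, $a$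 and $F$ are positive $C^2$ functions on an open set of values of $t$, $r>0$, $1-kr^2>0$, and $\mathrm d\Omega^2_{D-2}$ is the round metric of the unit sphere $S^{D-2}$ in arbitrary local coordinates. Let $\mathcal R_{(n)}$ be any real linear combination of curvature invariants of order $n$. Then there are an integer $p\ge 0$, real coefficients $\beta_1,\dots,\beta_p$ and non-negative integers $b_1^{(i)},b_2^{(i)},b_3^{(i)}$ with $b_1^{(i)}+2b_2^{(i)}+3b_3^{(i)}=n$, all depending only on $D$, $n$ and $\mathcal R_{(n)}$ (not on $k$, $a$, $F$ or the point), such that on every FLRW metric $$\mathcal R_{(n)}\big|_{\mathrm ds^2_{a,F}}=\sum_{i=1}^{p}\beta_i\,\Big(R^{b_1^{(i)}}\,\mathcal K_2^{b_2^{(i)}}\,\mathcal K_3^{b_3^{(i)}}\Big)\Big|_{\mathrm ds^2_{a,F}}.$$ Moreover, on every FLRW metric $\mathcal K_2=\Gamma^2$ and $\mathcal K_3=\Gamma^3$, where $$\Gamma=\frac{(D-2)\,(2kF^2+2F\dot a^2+a\dot a\dot F-2a\ddot aF)}{2a^2F^2D}.$$ -/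

import Mathlib

noncomputable section

namespace Curv

/-! ### Curvature of a metric in local coordinates indexed by `ι` -/

/-- The partial derivative `∂_i f` at `x`. -/
def pd {ι E : Type*} [Fintype ι] [DecidableEq ι] [NormedAddCommGroup E] [NormedSpace ℝ E]
    (i : ι) (f : (ι → ℝ) → E) (x : ι → ℝ) : E :=
  fderiv ℝ f x (Pi.single i 1)

variable {ι : Type*} [Fintype ι] [DecidableEq ι]

/-- The components `g^{ab}` of the inverse metric. -/
def invMetric (g : (ι → ℝ) → Matrix ι ι ℝ) (x : ι → ℝ) : Matrix ι ι ℝ := (g x)⁻¹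

/-- `christoffel g a b c x` is the Christoffel symbol `Γ_{ab}^c` of the metric `g` at `x`. -/
def christoffel (g : (ι → ℝ) → Matrix ι ι ℝ) (a b c : ι) (x : ι → ℝ) : ℝ :=
  (1 / 2) * ∑ d, invMetric g x c d *
    (pd a (fun y => g y b d) x + pd b (fun y => g y a d) x - pd d (fun y => g y a b) x)

/-- `riemann g a b c d x` is `R_{abc}^d = -2 ∂_{[a} Γ_{b]c}^d + 2 Γ_{c[a}^e Γ_{b]e}^d` at `x`. -/
def riemann (g : (ι → ℝ) → Matrix ι ι ℝ) (a b c d : ι) (x : ι → ℝ) : ℝ :=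
  -(pd a (christoffel g b c d) x - pd b (christoffel g a c d) x)
    + ∑ e, (christoffel g c a e x * christoffel g b e d x
        - christoffel g c b e x * christoffel g a e d x)

/-- The fully covariant Riemann tensor `R_{abcd} = R_{abc}^e g_{ed}`. -/
def riemannLow (g : (ι → ℝ) → Matrix ι ι ℝ) (a b c d : ι) (x : ι → ℝ) : ℝ :=
  ∑ e, riemann g a b c e x * g x e d

/-- The Ricci tensor `R_{ab} = R_{adb}^d`. -/
def ricci (g : (ι → ℝ) → Matrix ι ι ℝ) (a b : ι) (x : ι → ℝ) : ℝ :=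
  ∑ d, riemann g a d b d x

/-- The Ricci scalar `R = g^{ab} R_{ab}`. -/
def scalarCurv (g : (ι → ℝ) → Matrix ι ι ℝ) (x : ι → ℝ) : ℝ :=
  ∑ a, ∑ b, invMetric g x a b * ricci g a b x

/-- The traceless Ricci tensor `Z_{ab} = R_{ab} - (1/D) g_{ab} R`, `D` the dimension. -/
def tracelessRicci (g : (ι → ℝ) → Matrix ι ι ℝ) (a b : ι) (x : ι → ℝ) : ℝ :=
  ricci g a b x - (1 / (Fintype.card ι : ℝ)) * g x a b * scalarCurv g x

/-- `Z_a^b = Z_{ac} g^{cb}`. -/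
def tracelessRicciMixed (g : (ι → ℝ) → Matrix ι ι ℝ) (a b : ι) (x : ι → ℝ) : ℝ :=
  ∑ c, tracelessRicci g a c x * invMetric g x c b

/-- `Z^{ab} = g^{ac} Z_c^b`. -/
def tracelessRicciUp (g : (ι → ℝ) → Matrix ι ι ℝ) (a b : ι) (x : ι → ℝ) : ℝ :=
  ∑ c, invMetric g x a c * tracelessRicciMixed g c b x

/-- `K₂ = Z_{ab} Z^{ab} / (D (D - 1))`. -/
def K2 (g : (ι → ℝ) → Matrix ι ι ℝ) (x : ι → ℝ) : ℝ :=
  (1 / ((Fintype.card ι : ℝ) * ((Fintype.card ι : ℝ) - 1))) *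
    ∑ a, ∑ b, tracelessRicci g a b x * tracelessRicciUp g a b x

/-- `K₃ = - Z_{ab} Z^{bc} Z_c^a / (D (D - 1) (D - 2))`. -/
def K3 (g : (ι → ℝ) → Matrix ι ι ℝ) (x : ι → ℝ) : ℝ :=
  -(1 / ((Fintype.card ι : ℝ) * ((Fintype.card ι : ℝ) - 1) * ((Fintype.card ι : ℝ) - 2))) *
    ∑ a, ∑ b, ∑ c, tracelessRicci g a b x * tracelessRicciUp g b c x
      * tracelessRicciMixed g c a x

/-! ### Curvature invariants -/

/-- A way of contracting all the indices of a product of `n` Riemann tensors: the `4n` index slots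
(`(i, s)` is the slot `s` of the `i`-th factor) are grouped into `2n` pairs. -/
abbrev Pattern (n : ℕ) : Type := Fin n × Fin 4 ≃ Fin (2 * n) × Fin 2

/-- The complete contraction of `n` tensors `R_{abcd}` with `2n` inverse metrics `g^{ab}`, where
the `j`-th inverse metric is contracted with the two slots that form the `j`-th pair of `e`. -/
def contraction {n : ℕ} (e : Pattern n) (g : (ι → ℝ) → Matrix ι ι ℝ) (x : ι → ℝ) : ℝ :=
  ∑ v : Fin n × Fin 4 → ι,
    (∏ i, riemannLow g (v (i, 0)) (v (i, 1)) (v (i, 2)) (v (i, 3)) x) *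
      ∏ j, invMetric g x (v (e.symm (j, 0))) (v (e.symm (j, 1)))

/-- The linear combination with real coefficients `c` of the invariants of order `n` in the
curvature. -/
def curvInvariant {n : ℕ} (c : Pattern n → ℝ) (g : (ι → ℝ) → Matrix ι ι ℝ) (x : ι → ℝ) : ℝ :=
  ∑ e : Pattern n, c e * contraction e g x

/-! ### FLRW metrics -/

/-- `ψ`, on the open set `U`, is a smooth local parametrization (an immersion) of the unit sphere
`S^m` in `ℝ^(m+1)`, that is, a system of local coordinates on the sphere. -/
structure IsSphereParam {m : ℕ} (ψ : (Fin m → ℝ) → EuclideanSpace ℝ (Fin (m + 1)))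
    (U : Set (Fin m → ℝ)) : Prop where
  isOpen : IsOpen U
  smooth : ContDiffOn ℝ (⊤ : ℕ∞) ψ U
  norm_eq_one : ∀ y ∈ U, ‖ψ y‖ = 1
  immersion : ∀ y ∈ U, Function.Injective (fderiv ℝ ψ y)

/-- The components `⟨∂_i ψ, ∂_j ψ⟩` of the round metric `dΩ²` in the coordinates given by `ψ`. -/
def roundMetric {m : ℕ} (ψ : (Fin m → ℝ) → EuclideanSpace ℝ (Fin (m + 1))) (y : Fin m → ℝ) :
    Matrix (Fin m) (Fin m) ℝ :=
  Matrix.of fun i j => inner ℝ (pd i ψ y) (pd j ψ y)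

/-- The coordinate indices of a spacetime of dimension `m + 2`: `t`, `r`, and `m` coordinates on
the sphere `S^m`. -/
abbrev Idx (m : ℕ) : Type := Unit ⊕ Unit ⊕ Fin m

/-- The coordinate `t` of a point. -/
def tOf {m : ℕ} (x : Idx m → ℝ) : ℝ := x (Sum.inl ())

/-- The coordinate `r` of a point. -/
def rOf {m : ℕ} (x : Idx m → ℝ) : ℝ := x (Sum.inr (Sum.inl ()))

/-- The coordinates of a point on the sphere `S^m`. -/
def angOf {m : ℕ} (x : Idx m → ℝ) : Fin m → ℝ := fun i => x (Sum.inr (Sum.inr i))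

/-- The metric `-F(t) dt² + a(t)² / (1 - k r²) dr² + a(t)² r² dΩ_m²` in dimension `m + 2`. -/
def flrwMetric {m : ℕ} (k : ℝ) (a F : ℝ → ℝ)
    (ψ : (Fin m → ℝ) → EuclideanSpace ℝ (Fin (m + 1))) (x : Idx m → ℝ) :
    Matrix (Idx m) (Idx m) ℝ :=
  Matrix.of fun p q =>
    match p, q with
    | Sum.inl _, Sum.inl _ => -F (tOf x)
    | Sum.inr (Sum.inl _), Sum.inr (Sum.inl _) => a (tOf x) ^ 2 / (1 - k * rOf x ^ 2)
    | Sum.inr (Sum.inr i), Sum.inr (Sum.inr j) =>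
        a (tOf x) ^ 2 * rOf x ^ 2 * roundMetric ψ (angOf x) i j
    | _, _ => 0

/-- The function `Γ(t) = (D-2) (2 k F² + 2 F ȧ² + a ȧ Ḟ - 2 a ä F) / (2 a² F² D)`. -/
def flrwGamma (D : ℕ) (k : ℝ) (a F : ℝ → ℝ) (t : ℝ) : ℝ :=
  ((D : ℝ) - 2) * (2 * k * F t ^ 2 + 2 * F t * deriv a t ^ 2 + a t * deriv a t * deriv F t
      - 2 * a t * deriv (deriv a) t * F t) / (2 * a t ^ 2 * F t ^ 2 * (D : ℝ))

end Curv

end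

open Filter Topology

namespace Curv

/-! ### Calculus of coordinate partial derivatives. -/

section PartialDerivatives

variable {ι : Type*} [Fintype ι] [DecidableEq ι]

/-! An FLRW metric is a warped product over the time axis whose fibre has constant curvature `k`;
the fibre is itself a warped product over the `r` axis with fibre the unit sphere. The Gauss
equation gives the sphere curvature one (`IsSphereParam.riemannLow_roundMetric`), and two uses of
`riemannLow_warp` show that the FLRW Riemann tensor is built algebraically from `g` and `q = F dt²`
with two scalars `α`, `β` (`curvForm`). There is no Weyl part: the tensor is linear in `R` and `Γ`,
where `Γ` is a fixed multiple of `β`.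

The mixed tensor `P = q g⁻¹` satisfies `P² = -P` and `tr P = -1`, so the trace-free Ricci tensor `Γ
(1 + D P)` has eigenvalues `Γ` (`D - 1` times) and `(1 - D) Γ`. Its power sums give `K₂ = Γ²` and
`K₃ = Γ³`.

In a frame orthonormal over `ℂ`, the curvature becomes `R A + Γ B` with constant tensors `A`, `B`
depending only on `D`. Expanding a complete contraction gives `∑ c_j R^(n-j) Γ^j` with universal
`c_j` (`contraction_eq_sum`, `curvInvariant_eq_sum`). Every `j ≠ 1` has the form `2 b₂ + 3 b₃`, so
`Γ^j` is a product of powers of `K₂` and `K₃`. The remaining `c_1` vanishes because a scalar linear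
in a trace-free tensor and otherwise built from the metric is a multiple of the trace
(`fullContraction_linear_eq_zero`). -/

theorem pd_congr {E : Type*} [NormedAddCommGroup E] [NormedSpace ℝ E] {f g : (ι → ℝ) → E}
    {x : ι → ℝ} (i : ι) (h : f =ᶠ[𝓝 x] g) : pd i f x = pd i g x := by
  simp only [pd, h.fderiv_eq]

theorem pd_mul {f g : (ι → ℝ) → ℝ} {x : ι → ℝ} (i : ι) (hf : DifferentiableAt ℝ f x)
    (hg : DifferentiableAt ℝ g x) :
    pd i (fun y => f y * g y) x = pd i f x * g x + f x * pd i g x := by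
  simp only [pd, fderiv_fun_mul hf hg]
  simp
  ring

theorem pd_sum {α : Type*} [Fintype α] {f : α → (ι → ℝ) → ℝ} {x : ι → ℝ} (i : ι)
    (hf : ∀ a, DifferentiableAt ℝ (f a) x) :
    pd i (fun y => ∑ a, f a y) x = ∑ a, pd i (f a) x := by
  simp only [pd]
  rw [fderiv_fun_sum fun a _ => hf a]
  simp

theorem ContDiffAt.pd_differentiableAt {E : Type*} [NormedAddCommGroup E] [NormedSpace ℝ E]
    {f : (ι → ℝ) → E} {x : ι → ℝ} (hf : ContDiffAt ℝ 2 f x) (i : ι) :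
    DifferentiableAt ℝ (pd i f) x :=
  ((hf.fderiv_right (m := 1) (by norm_num)).differentiableAt (by norm_num)).clm_apply
    (differentiableAt_const _)

end PartialDerivatives

/-! ### The Riemann tensor through Christoffel symbols of the first kind. -/

section LoweredFormula

variable {ι : Type*} [Fintype ι] [DecidableEq ι]

/-- The Christoffel symbol of the first kind `Γ_{ab,d}`. -/
noncomputable def christoffelLow (g : (ι → ℝ) → Matrix ι ι ℝ) (a b d : ι) (x : ι → ℝ) : ℝ :=
  (1 / 2) * (pd a (fun y => g y b d) x + pd b (fun y => g y a d) x - pd d (fun y => g y a b) x)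

theorem christoffel_eq_sum (g : (ι → ℝ) → Matrix ι ι ℝ) (a b c : ι) (x : ι → ℝ) :
    christoffel g a b c x = ∑ d, invMetric g x c d * christoffelLow g a b d x := by
  simp only [christoffel, christoffelLow, Finset.mul_sum]
  exact Finset.sum_congr rfl fun _ _ => by ring

variable {g : (ι → ℝ) → Matrix ι ι ℝ} {x : ι → ℝ}

theorem christoffelLow_symm (hs : ∀ y, (g y).IsSymm) (a b d : ι) :
    christoffelLow g a b d = christoffelLow g b a d := by
  funext y
  simp only [christoffelLow, fun z => (hs z).apply a b]
  ring

theorem christoffel_symm (hs : ∀ y, (g y).IsSymm) (a b d : ι) :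
    christoffel g a b d = christoffel g b a d := by
  funext y
  simp only [christoffel_eq_sum, christoffelLow_symm hs a b]

theorem pd_metric (hs : ∀ y, (g y).IsSymm) (a d f : ι) :
    pd a (fun y => g y d f) x = christoffelLow g a d f x + christoffelLow g a f d x := by
  simp only [christoffelLow, fun z => (hs z).apply f d]
  ring

theorem differentiableAt_det_of_entries {A : (ι → ℝ) → Matrix ι ι ℝ}
    (h : ∀ i j, DifferentiableAt ℝ (fun y => A y i j) x) :
    DifferentiableAt ℝ (fun y => (A y).det) x := by
  simp only [Matrix.det_apply']
  fun_prop

/-- Cramer's rule: an entry of the inverse is a determinant of a row-updated matrix divided by `det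
g`. -/
theorem differentiableAt_invMetric (hg : ∀ i j, DifferentiableAt ℝ (fun y => g y i j) x)
    (hd : (g x).det ≠ 0) (i j : ι) : DifferentiableAt ℝ (fun y => invMetric g y i j) x := by
  simp only [invMetric, Matrix.inv_def, Matrix.smul_apply, Ring.inverse_eq_inv', smul_eq_mul,
    Matrix.adjugate_apply]
  refine ((differentiableAt_det_of_entries hg).inv hd).mul (differentiableAt_det_of_entries ?_)
  intro k l
  by_cases hk : k = j
  · subst hk
    simp
  · simpa [Matrix.updateRow_ne hk] using hg k l

theorem eventually_det_ne_zero (hg : ∀ i j, DifferentiableAt ℝ (fun y => g y i j) x)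
    (hd : (g x).det ≠ 0) : ∀ᶠ y in 𝓝 x, (g y).det ≠ 0 :=
  (differentiableAt_det_of_entries hg).continuousAt.eventually_ne hd

theorem sum_christoffel_mul_metric (hs : ∀ y, (g y).IsSymm) (hd : (g x).det ≠ 0) (b c f : ι) :
    ∑ d, christoffel g b c d x * g x d f = christoffelLow g b c f x := by
  have h1 : g x * (g x)⁻¹ = 1 := Matrix.mul_nonsing_inv _ (isUnit_iff_ne_zero.2 hd)
  simp only [christoffel_eq_sum, Finset.sum_mul]
  rw [Finset.sum_comm]
  have h2 : ∀ e, ∑ d, g x f d * (g x)⁻¹ d e = if f = e then 1 else 0 := fun e => by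
    rw [← Matrix.mul_apply, h1, Matrix.one_apply]
  calc _ = ∑ e, (∑ d, g x f d * (g x)⁻¹ d e) * christoffelLow g b c e x := by
        refine Finset.sum_congr rfl fun e _ => ?_
        rw [Finset.sum_mul]
        refine Finset.sum_congr rfl fun d _ => ?_
        rw [(hs x).apply f d, invMetric]
        ring
    _ = _ := by simp [h2]

theorem differentiableAt_christoffelLow (hg : ∀ i j, ContDiffAt ℝ 2 (fun y => g y i j) x)
    (a b d : ι) : DifferentiableAt ℝ (christoffelLow g a b d) x := by
  have := fun i j k => ContDiffAt.pd_differentiableAt (hg i j) k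
  exact (((this b d a).add (this a d b)).sub (this a b d)).const_mul _

theorem differentiableAt_christoffel (hg : ∀ i j, ContDiffAt ℝ 2 (fun y => g y i j) x)
    (hd : (g x).det ≠ 0) (a b c : ι) : DifferentiableAt ℝ (christoffel g a b c) x := by
  have h : christoffel g a b c = fun y => ∑ d, invMetric g y c d * christoffelLow g a b d y :=
    funext fun y => christoffel_eq_sum g a b c y
  rw [h]
  have h1 := differentiableAt_invMetric (fun i j => (hg i j).differentiableAt (by norm_num)) hd
  have h2 := differentiableAt_christoffelLow hg
  exact DifferentiableAt.fun_sum fun d _ => (h1 c d).mul (h2 a b d)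

/-- The product rule for `Γ_{bc}^d g_{df} = Γ_{bc,f}`, with `∂g` replaced by Christoffel symbols.
Lowering the index under the derivative avoids ever differentiating the inverse metric explicitly.
-/
theorem sum_pd_christoffel_mul_metric (hs : ∀ y, (g y).IsSymm)
    (hg : ∀ i j, ContDiffAt ℝ 2 (fun y => g y i j) x) (hd : (g x).det ≠ 0) (a b c f : ι) :
    ∑ d, pd a (christoffel g b c d) x * g x d f = pd a (christoffelLow g b c f) x
      - ∑ d, christoffel g b c d x * (christoffelLow g a d f x + christoffelLow g a f d x) := by
  have hg1 : ∀ i j, DifferentiableAt ℝ (fun y => g y i j) x :=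
    fun i j => (hg i j).differentiableAt (by norm_num)
  have hev : christoffelLow g b c f =ᶠ[𝓝 x] fun y => ∑ d, christoffel g b c d y * g y d f := by
    filter_upwards [eventually_det_ne_zero hg1 hd] with y hy
    exact (sum_christoffel_mul_metric hs hy b c f).symm
  have h2 := differentiableAt_christoffel hg hd
  rw [pd_congr a hev, pd_sum a fun d => (h2 b c d).fun_mul (hg1 d f), ← Finset.sum_sub_distrib]
  refine Finset.sum_congr rfl fun d _ => ?_
  rw [pd_mul a (h2 b c d) (hg1 d f), pd_metric hs]
  ring

/-- The contraction `Γ_{ab,p} g^{pq} Γ_{cd,q}`. -/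
noncomputable def christoffelSq (g : (ι → ℝ) → Matrix ι ι ℝ) (a b c d : ι) (x : ι → ℝ) : ℝ :=
  ∑ p, ∑ q, invMetric g x p q * christoffelLow g a b q x * christoffelLow g c d p x

/-- The fully covariant Riemann tensor in terms of Christoffel symbols of the first kind. -/
theorem riemannLow_eq (hs : ∀ y, (g y).IsSymm)
    (hg : ∀ i j, ContDiffAt ℝ 2 (fun y => g y i j) x) (hd : (g x).det ≠ 0) (a b c f : ι) :
    riemannLow g a b c f x = -pd a (christoffelLow g b c f) x + pd b (christoffelLow g a c f) x
      + christoffelSq g b c a f x - christoffelSq g a c b f x := by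
  have hQ : ∀ a b c d, christoffelSq g a b c d x
      = ∑ p, christoffel g a b p x * christoffelLow g c d p x := fun a b c d => by
    simp only [christoffelSq, christoffel_eq_sum, Finset.sum_mul]
  have hS : ∑ d, (∑ e, (christoffel g c a e x * christoffel g b e d x
        - christoffel g c b e x * christoffel g a e d x)) * g x d f
      = ∑ e, (christoffel g a c e x * christoffelLow g b e f x
        - christoffel g b c e x * christoffelLow g a e f x) := by
    simp only [Finset.sum_mul]
    rw [Finset.sum_comm]
    refine Finset.sum_congr rfl fun e _ => ?_
    rw [← sum_christoffel_mul_metric hs hd, ← sum_christoffel_mul_metric hs hd, Finset.mul_sum,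
      Finset.mul_sum, ← Finset.sum_sub_distrib, christoffel_symm hs c a, christoffel_symm hs c b]
    exact Finset.sum_congr rfl fun _ _ => by ring
  have hR : riemannLow g a b c f x = -(∑ d, pd a (christoffel g b c d) x * g x d f)
      + (∑ d, pd b (christoffel g a c d) x * g x d f)
      + ∑ d, (∑ e, (christoffel g c a e x * christoffel g b e d x
        - christoffel g c b e x * christoffel g a e d x)) * g x d f := by
    rw [riemannLow, ← Finset.sum_neg_distrib, ← Finset.sum_add_distrib, ← Finset.sum_add_distrib]
    exact Finset.sum_congr rfl fun _ _ => by rw [riemann]; ring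
  rw [hR, hS, sum_pd_christoffel_mul_metric hs hg hd, sum_pd_christoffel_mul_metric hs hg hd,
    hQ, hQ]
  simp only [mul_add, Finset.sum_add_distrib, Finset.sum_sub_distrib]
  ring

end LoweredFormula

/-! ### The round sphere via the Gauss equation. -/

section Sphere

theorem pd_inner {ι : Type*} [Fintype ι] [DecidableEq ι] {E : Type*} [NormedAddCommGroup E]
    [InnerProductSpace ℝ E] {f g : (ι → ℝ) → E} {x : ι → ℝ} (i : ι)
    (hf : DifferentiableAt ℝ f x) (hg : DifferentiableAt ℝ g x) :
    pd i (fun y => inner ℝ (f y) (g y)) x = inner ℝ (pd i f x) (g x) + inner ℝ (f x) (pd i g x) := by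
  simp only [pd]
  rw [fderiv_inner_apply ℝ hf hg]
  ring

theorem pd_pd {ι : Type*} [Fintype ι] [DecidableEq ι] {E : Type*} [NormedAddCommGroup E]
    [NormedSpace ℝ E] {f : (ι → ℝ) → E} {x : ι → ℝ} (hf : ContDiffAt ℝ 2 f x) (i j : ι) :
    pd i (pd j f) x = fderiv ℝ (fderiv ℝ f) x (Pi.single i 1) (Pi.single j 1) := by
  have h : DifferentiableAt ℝ (fderiv ℝ f) x :=
    (hf.fderiv_right (m := 1) (by norm_num)).differentiableAt (by norm_num)
  have h2 : pd j f = fun y => fderiv ℝ f y (Pi.single j 1) := rfl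
  rw [pd, h2, fderiv_clm_apply h (differentiableAt_const _)]
  simp

theorem pd_comm {ι : Type*} [Fintype ι] [DecidableEq ι] {E : Type*} [NormedAddCommGroup E]
    [NormedSpace ℝ E] {f : (ι → ℝ) → E} {x : ι → ℝ} (hf : ContDiffAt ℝ 2 f x) (i j : ι) :
    pd i (pd j f) x = pd j (pd i f) x := by
  rw [pd_pd hf, pd_pd hf, (hf.isSymmSndFDerivAt (by simp)).eq]

theorem ContDiffAt.pd_contDiffAt {ι : Type*} [Fintype ι] [DecidableEq ι] {E : Type*}
    [NormedAddCommGroup E] [NormedSpace ℝ E] {f : (ι → ℝ) → E} {x : ι → ℝ} {n m : WithTop ℕ∞}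
    (hf : ContDiffAt ℝ n f x) (hmn : m + 1 ≤ n) (i : ι) : ContDiffAt ℝ m (pd i f) x :=
  (hf.fderiv_right hmn).clm_apply contDiffAt_const

/-- Parseval's identity for a basis that consists of the vectors `e i` and of a unit vector
orthogonal to them. -/
theorem inner_eq_sum_inv_gram_add {m : ℕ} {E : Type*} [NormedAddCommGroup E]
    [InnerProductSpace ℝ E] [FiniteDimensional ℝ E] (hE : Module.finrank ℝ E = m + 1)
    {e : Fin m → E} {n : E} (he : LinearIndependent ℝ e) (hn : inner ℝ n n = (1 : ℝ))
    (hen : ∀ i, inner ℝ (e i) n = (0 : ℝ)) {G : Matrix (Fin m) (Fin m) ℝ}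
    (hG : ∀ i j, G i j = inner ℝ (e i) (e j)) (hd : G.det ≠ 0) (v w : E) :
    (inner ℝ v w : ℝ) = (∑ p, ∑ q, G⁻¹ p q * inner ℝ v (e q) * inner ℝ w (e p))
      + inner ℝ v n * inner ℝ w n := by
  -- The unit vector `n` is orthogonal to the span of the `e i`, hence outside it; the `m + 1`
  -- independent vectors then span by dimension.
  have hspan : Submodule.span ℝ (Set.range fun o : Option (Fin m) => o.elim n e) = ⊤ := by
    refine LinearIndependent.span_eq_top_of_card_eq_finrank' ?_ (by simp [hE])
    refine linearIndependent_option.2 ⟨he, fun hmem => ?_⟩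
    have hle : Submodule.span ℝ (Set.range e) ≤ (ℝ ∙ n)ᗮ := by
      rw [Submodule.span_le]
      rintro _ ⟨i, rfl⟩
      exact Submodule.mem_orthogonal_singleton_iff_inner_left.2 (hen i)
    have := Submodule.mem_orthogonal_singleton_iff_inner_left.1 (hle hmem)
    exact one_ne_zero (hn.symm.trans this)
  -- The residual of `v` after removing its tangential and normal parts; it is orthogonal to a
  -- spanning family, so it vanishes.
  set u : E := v - (∑ p, (∑ q, G⁻¹ p q * inner ℝ v (e q)) • e p) - (inner ℝ v n : ℝ) • n with hu
  have hinv : G⁻¹ * G = 1 := Matrix.nonsing_inv_mul _ (isUnit_iff_ne_zero.2 hd)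
  have hGs : G.IsSymm := by
    ext i j
    simp [Matrix.transpose_apply, hG, real_inner_comm]
  have hinvs : (G⁻¹).IsSymm := by
    rw [Matrix.IsSymm, Matrix.transpose_nonsing_inv, hGs]
  have hue : ∀ i, inner ℝ (e i) u = (0 : ℝ) := fun i => by
    rw [hu, inner_sub_right, inner_sub_right, inner_sum, inner_smul_right, hen, mul_zero, sub_zero]
    have : ∀ q, ∑ p, G⁻¹ q p * G p i = if q = i then 1 else 0 := fun q => by
      rw [← Matrix.mul_apply, hinv, Matrix.one_apply]
    calc _ = inner ℝ (e i) v - ∑ q, inner ℝ v (e q) * ∑ p, G⁻¹ q p * G p i := by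
          congr 1
          simp only [inner_smul_right, Finset.sum_mul, Finset.mul_sum]
          rw [Finset.sum_comm]
          refine Finset.sum_congr rfl fun q _ => Finset.sum_congr rfl fun p _ => ?_
          rw [hG p i, hinvs.apply q p, real_inner_comm (e i) (e p)]
          ring
      _ = 0 := by simp [this, real_inner_comm]
  have hun : inner ℝ n u = (0 : ℝ) := by
    rw [hu, inner_sub_right, inner_sub_right, inner_sum, inner_smul_right, hn]
    simp [inner_smul_right, real_inner_comm v, fun p => (real_inner_comm (e p) n).trans (hen p)]
  have hu0 : u = 0 := by
    have hmem : u ∈ (⊤ : Submodule ℝ E)ᗮ := by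
      rw [← hspan, Submodule.mem_orthogonal]
      intro y hy
      induction hy using Submodule.span_induction with
      | mem y hy =>
        obtain ⟨o, rfl⟩ := hy
        cases o with
        | none => exact hun
        | some i => exact hue i
      | zero => simp
      | add y z _ _ hy hz => rw [inner_add_left, hy, hz, add_zero]
      | smul c y _ hy => rw [inner_smul_left, hy, mul_zero]
    simpa using hmem
  have hv : v = (∑ p, (∑ q, G⁻¹ p q * inner ℝ v (e q)) • e p) + (inner ℝ v n : ℝ) • n := by
    rw [hu, sub_sub, sub_eq_zero] at hu0
    exact hu0
  conv_lhs => rw [hv]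
  rw [inner_add_left, sum_inner, real_inner_smul_left, ← real_inner_comm w n]
  simp only [real_inner_smul_left, Finset.sum_mul, ← real_inner_comm w]

variable {m : ℕ} {ψ : (Fin m → ℝ) → EuclideanSpace ℝ (Fin (m + 1))} {U : Set (Fin m → ℝ)}
  {y : Fin m → ℝ}

theorem IsSphereParam.contDiffAt (h : IsSphereParam ψ U) (hy : y ∈ U) (n : ℕ) :
    ContDiffAt ℝ n ψ y :=
  contDiffAt_infty.1 (h.smooth.contDiffAt (h.isOpen.mem_nhds hy)) n

theorem IsSphereParam.linearIndependent (h : IsSphereParam ψ U) (hy : y ∈ U) :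
    LinearIndependent ℝ fun i => pd i ψ y := by
  have h1 := (Pi.basisFun ℝ (Fin m)).linearIndependent.map' (fderiv ℝ ψ y).toLinearMap
    (LinearMap.ker_eq_bot.2 (h.immersion y hy))
  have h2 : (fun i => pd i ψ y) = (fderiv ℝ ψ y).toLinearMap ∘ Pi.basisFun ℝ (Fin m) := by
    funext i
    simp [pd]
  rwa [h2]

theorem IsSphereParam.roundMetric_posDef (h : IsSphereParam ψ U) (hy : y ∈ U) :
    (roundMetric ψ y).PosDef :=
  Matrix.posDef_gram_of_linearIndependent (h.linearIndependent hy)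

theorem roundMetric_isSymm (ψ : (Fin m → ℝ) → EuclideanSpace ℝ (Fin (m + 1))) (y : Fin m → ℝ) :
    (roundMetric ψ y).IsSymm := by
  ext i j
  simp [roundMetric, real_inner_comm]

theorem IsSphereParam.roundMetric_contDiffAt (h : IsSphereParam ψ U) (hy : y ∈ U) (i j : Fin m) :
    ContDiffAt ℝ 2 (fun z => roundMetric ψ z i j) y := by
  have h1 : ∀ i, ContDiffAt ℝ 2 (pd i ψ) y :=
    ContDiffAt.pd_contDiffAt (h.contDiffAt hy 3) (by norm_num)
  exact (h1 i).inner ℝ (h1 j)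

theorem IsSphereParam.inner_pd_self (h : IsSphereParam ψ U) (hy : y ∈ U) (i : Fin m) :
    inner ℝ (pd i ψ y) (ψ y) = (0 : ℝ) := by
  have hd : DifferentiableAt ℝ ψ y := (h.contDiffAt hy 2).differentiableAt (by simp)
  have h1 : (fun z => (inner ℝ (ψ z) (ψ z) : ℝ)) =ᶠ[𝓝 y] fun _ => 1 := by
    filter_upwards [h.isOpen.mem_nhds hy] with z hz
    rw [real_inner_self_eq_norm_sq, h.norm_eq_one z hz, one_pow]
  have h2 := pd_congr i h1
  rw [pd_inner i hd hd, real_inner_comm (pd i ψ y)] at h2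
  simp only [pd, fderiv_fun_const] at h2 ⊢
  simp at h2
  linarith

/-- Differentiating `⟨∂_j ψ, ψ⟩ = 0` once more: the second fundamental form for the normal `ψ` is
minus the metric. -/
theorem IsSphereParam.inner_pd_pd_self (h : IsSphereParam ψ U) (hy : y ∈ U) (i j : Fin m) :
    inner ℝ (pd i (pd j ψ) y) (ψ y) = -roundMetric ψ y i j := by
  have hd : DifferentiableAt ℝ ψ y := (h.contDiffAt hy 2).differentiableAt (by simp)
  have hd2 : DifferentiableAt ℝ (pd j ψ) y :=
    ContDiffAt.pd_differentiableAt (h.contDiffAt hy 2) j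
  have h1 : (fun z => (inner ℝ (pd j ψ z) (ψ z) : ℝ)) =ᶠ[𝓝 y] fun _ => 0 := by
    filter_upwards [h.isOpen.mem_nhds hy] with z hz
    exact h.inner_pd_self hz j
  have h2 := pd_congr i h1
  rw [pd_inner i hd2 hd] at h2
  simp only [roundMetric, Matrix.of_apply, real_inner_comm (pd j ψ y)]
  simp only [pd, fderiv_fun_const] at h2 ⊢
  simp at h2
  linarith

theorem IsSphereParam.christoffelLow_roundMetric (h : IsSphereParam ψ U) (hy : y ∈ U)
    (i j k : Fin m) :
    christoffelLow (roundMetric ψ) i j k y = inner ℝ (pd i (pd j ψ) y) (pd k ψ y) := by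
  have hc : ContDiffAt ℝ 2 ψ y := h.contDiffAt hy 2
  have hd : ∀ j, DifferentiableAt ℝ (pd j ψ) y := ContDiffAt.pd_differentiableAt hc
  simp only [christoffelLow, roundMetric, Matrix.of_apply]
  rw [pd_inner _ (hd _) (hd _), pd_inner _ (hd _) (hd _), pd_inner _ (hd _) (hd _),
    pd_comm hc j i, pd_comm hc k i, pd_comm hc k j, real_inner_comm (pd j ψ y)]
  ring

/-- The unit sphere has constant curvature one. -/
theorem IsSphereParam.riemannLow_roundMetric (h : IsSphereParam ψ U) (hy : y ∈ U)
    (a b c f : Fin m) :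
    riemannLow (roundMetric ψ) a b c f y = roundMetric ψ y a c * roundMetric ψ y b f
      - roundMetric ψ y a f * roundMetric ψ y b c := by
  have hc : ∀ c, ContDiffAt ℝ 2 (pd c ψ) y :=
    ContDiffAt.pd_contDiffAt (h.contDiffAt hy 3) (by norm_num)
  have hd := fun c => (hc c).differentiableAt (by norm_num)
  have hdd := fun b c => ContDiffAt.pd_differentiableAt (hc c) b
  have hdet : (roundMetric ψ y).det ≠ 0 := (h.roundMetric_posDef hy).det_pos.ne'
  have hpd : ∀ a b c f, pd a (christoffelLow (roundMetric ψ) b c f) y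
      = inner ℝ (pd a (pd b (pd c ψ)) y) (pd f ψ y)
        + inner ℝ (pd b (pd c ψ) y) (pd a (pd f ψ) y) := fun a b c f => by
    rw [← pd_inner a (hdd b c) (hd f)]
    refine pd_congr a ?_
    filter_upwards [h.isOpen.mem_nhds hy] with z hz
    exact h.christoffelLow_roundMetric hz b c f
  -- The contraction sees only tangential parts of the second derivatives of `ψ`. By Parseval it is
  -- the full inner product minus the normal contribution, and this contribution is what survives as
  -- curvature.
  have hsq : ∀ a b c d, christoffelSq (roundMetric ψ) a b c d y
      = inner ℝ (pd a (pd b ψ) y) (pd c (pd d ψ) y)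
        - roundMetric ψ y a b * roundMetric ψ y c d := fun a b c d => by
    have hn : inner ℝ (ψ y) (ψ y) = (1 : ℝ) := by
      rw [real_inner_self_eq_norm_sq, h.norm_eq_one y hy, one_pow]
    rw [inner_eq_sum_inv_gram_add (by simp) (h.linearIndependent hy) hn (h.inner_pd_self hy)
      (G := roundMetric ψ y) (fun _ _ => rfl) hdet, h.inner_pd_pd_self hy, h.inner_pd_pd_self hy]
    simp only [christoffelSq, h.christoffelLow_roundMetric hy, invMetric]
    ring
  -- The third derivatives cancel once `∂_a` and `∂_b` are commuted, and the inner products of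
  -- second derivatives cancel in pairs.
  rw [riemannLow_eq (roundMetric_isSymm ψ) (h.roundMetric_contDiffAt hy) hdet, hpd, hpd, hsq, hsq,
    pd_comm (hc c) a b]
  ring

end Sphere

/-! ### Warped products over an interval: metric and Christoffel symbols. -/

section Warped

theorem hasFDerivAt_comp_inl {κ : Type*} [Fintype κ] {p : ℝ → ℝ} {x : Unit ⊕ κ → ℝ}
    (hp : DifferentiableAt ℝ p (x (Sum.inl ()))) :
    HasFDerivAt (fun z : Unit ⊕ κ → ℝ => p (z (Sum.inl ())))
      (deriv p (x (Sum.inl ())) •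
        ContinuousLinearMap.proj (R := ℝ) (φ := fun _ : Unit ⊕ κ => ℝ) (Sum.inl ())) x :=
  hp.hasDerivAt.comp_hasFDerivAt x (hasFDerivAt_apply (𝕜 := ℝ) (Sum.inl ()) x)

theorem hasFDerivAt_comp_inr {κ : Type*} [Fintype κ] {q : (κ → ℝ) → ℝ} {x : Unit ⊕ κ → ℝ}
    (hq : DifferentiableAt ℝ q fun i => x (Sum.inr i)) :
    HasFDerivAt (fun z : Unit ⊕ κ → ℝ => q fun i => z (Sum.inr i))
      ((fderiv ℝ q fun i => x (Sum.inr i)).comp (ContinuousLinearMap.pi fun i : κ =>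
        ContinuousLinearMap.proj (R := ℝ) (φ := fun _ : Unit ⊕ κ => ℝ) (Sum.inr i))) x :=
  HasFDerivAt.comp (f := fun (z : Unit ⊕ κ → ℝ) i => z (Sum.inr i)) x hq.hasFDerivAt
    (hasFDerivAt_pi.2 fun i => hasFDerivAt_apply (Sum.inr i) x)

/-- The warped product metric `N(t) dt² + b(t)² h`. -/
def warp {κ : Type*} (N b : ℝ → ℝ) (h : (κ → ℝ) → Matrix κ κ ℝ) (x : Unit ⊕ κ → ℝ) :
    Matrix (Unit ⊕ κ) (Unit ⊕ κ) ℝ :=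
  Matrix.fromBlocks (Matrix.of fun _ _ => N (x (Sum.inl ()))) 0 0
    (b (x (Sum.inl ())) ^ 2 • h fun i => x (Sum.inr i))

theorem warp_isSymm {κ : Type*} {N b : ℝ → ℝ} {h : (κ → ℝ) → Matrix κ κ ℝ}
    (hs : ∀ y, (h y).IsSymm) (x : Unit ⊕ κ → ℝ) : (warp N b h x).IsSymm := by
  rw [warp, Matrix.isSymm_fromBlocks_iff]
  refine ⟨?_, by simp, by simp, (hs _).smul _⟩
  ext
  simp

theorem warp_contDiffAt {κ : Type*} [Fintype κ] {N b : ℝ → ℝ} {h : (κ → ℝ) → Matrix κ κ ℝ}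
    {x : Unit ⊕ κ → ℝ} (hN : ContDiffAt ℝ 2 N (x (Sum.inl ())))
    (hb : ContDiffAt ℝ 2 b (x (Sum.inl ())))
    (hh : ∀ i j, ContDiffAt ℝ 2 (fun y => h y i j) fun i => x (Sum.inr i))
    (i j : Unit ⊕ κ) : ContDiffAt ℝ 2 (fun z => warp N b h z i j) x := by
  have hl : ContDiffAt ℝ 2 (fun z : Unit ⊕ κ → ℝ => z (Sum.inl ())) x :=
    (contDiff_apply ℝ ℝ _).contDiffAt
  have hr : ContDiffAt ℝ 2 (fun (z : Unit ⊕ κ → ℝ) (i : κ) => z (Sum.inr i)) x :=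
    contDiffAt_pi.2 fun i => (contDiff_apply ℝ ℝ _).contDiffAt
  rcases i with i | i <;> rcases j with j | j
  · exact ContDiffAt.comp x hN hl
  · exact contDiffAt_const
  · exact contDiffAt_const
  · exact ((ContDiffAt.comp x hb hl).pow 2).mul (ContDiffAt.comp (g := fun y => h y i j) x (hh i j) hr)

variable {κ : Type*} [Fintype κ] [DecidableEq κ]

theorem pd_inl_mul {p : ℝ → ℝ} {q : (κ → ℝ) → ℝ} {x : Unit ⊕ κ → ℝ}
    (hp : DifferentiableAt ℝ p (x (Sum.inl ())))
    (hq : DifferentiableAt ℝ q fun i => x (Sum.inr i)) (u : Unit) :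
    pd (Sum.inl u) (fun z : Unit ⊕ κ → ℝ => p (z (Sum.inl ())) * q fun i => z (Sum.inr i)) x
      = deriv p (x (Sum.inl ())) * q fun i => x (Sum.inr i) := by
  have h1 := hasFDerivAt_comp_inl hp
  have h2 := hasFDerivAt_comp_inr hq
  rw [pd_mul _ h1.differentiableAt h2.differentiableAt, pd, pd, h1.fderiv, h2.fderiv]
  have h3 : (ContinuousLinearMap.pi fun i : κ => ContinuousLinearMap.proj (R := ℝ)
      (φ := fun _ : Unit ⊕ κ => ℝ) (Sum.inr i)) (Pi.single (Sum.inl u) 1) = 0 := by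
    ext i
    simp
  rw [ContinuousLinearMap.comp_apply, h3]
  simp

theorem pd_inr_mul {p : ℝ → ℝ} {q : (κ → ℝ) → ℝ} {x : Unit ⊕ κ → ℝ}
    (hp : DifferentiableAt ℝ p (x (Sum.inl ())))
    (hq : DifferentiableAt ℝ q fun i => x (Sum.inr i)) (k : κ) :
    pd (Sum.inr k) (fun z : Unit ⊕ κ → ℝ => p (z (Sum.inl ())) * q fun i => z (Sum.inr i)) x
      = p (x (Sum.inl ())) * pd k q fun i => x (Sum.inr i) := by
  have h1 := hasFDerivAt_comp_inl hp
  have h2 := hasFDerivAt_comp_inr hq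
  rw [pd_mul _ h1.differentiableAt h2.differentiableAt, pd, pd, h1.fderiv, h2.fderiv]
  have h3 : (ContinuousLinearMap.pi fun i : κ => ContinuousLinearMap.proj (R := ℝ)
      (φ := fun _ : Unit ⊕ κ => ℝ) (Sum.inr i)) (Pi.single (Sum.inr k) 1) = Pi.single k 1 := by
    ext i
    simp [Pi.single_apply]
  rw [ContinuousLinearMap.comp_apply, h3]
  simp [pd]

variable {N b : ℝ → ℝ} {h : (κ → ℝ) → Matrix κ κ ℝ} {x : Unit ⊕ κ → ℝ}

theorem warp_det (N b : ℝ → ℝ) (h : (κ → ℝ) → Matrix κ κ ℝ) (x : Unit ⊕ κ → ℝ) :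
    (warp N b h x).det = N (x (Sum.inl ())) *
      ((b (x (Sum.inl ())) ^ 2) ^ Fintype.card κ * (h fun i => x (Sum.inr i)).det) := by
  rw [warp, Matrix.det_fromBlocks_zero₂₁, Matrix.det_smul]
  simp

theorem warp_inv (hN : N (x (Sum.inl ())) ≠ 0) (hb : b (x (Sum.inl ())) ≠ 0)
    (hd : (h fun i => x (Sum.inr i)).det ≠ 0) :
    (warp N b h x)⁻¹ = Matrix.fromBlocks (Matrix.of fun _ _ => (N (x (Sum.inl ())))⁻¹) 0 0
      ((b (x (Sum.inl ())) ^ 2)⁻¹ • (h fun i => x (Sum.inr i))⁻¹) := by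
  refine Matrix.inv_eq_right_inv ?_
  rw [warp, Matrix.fromBlocks_multiply, ← Matrix.fromBlocks_one]
  congr 1
  · ext
    simp [Matrix.mul_apply, hN]
  · simp
  · simp
  · rw [Matrix.smul_mul, Matrix.mul_smul, smul_smul,
      Matrix.mul_nonsing_inv _ (isUnit_iff_ne_zero.2 hd)]
    simp [hb]

/-- The factor of the Christoffel symbols of a warped product that depends on `t`. -/
noncomputable def warpBase (N b : ℝ → ℝ) : Unit ⊕ κ → Unit ⊕ κ → Unit ⊕ κ → ℝ → ℝ
  | Sum.inl _, Sum.inl _, Sum.inl _ => fun t => deriv N t / 2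
  | Sum.inl _, Sum.inr _, Sum.inr _ => fun t => b t * deriv b t
  | Sum.inr _, Sum.inl _, Sum.inr _ => fun t => b t * deriv b t
  | Sum.inr _, Sum.inr _, Sum.inl _ => fun t => -(b t * deriv b t)
  | Sum.inr _, Sum.inr _, Sum.inr _ => fun t => b t ^ 2
  | _, _, _ => fun _ => 0

/-- The factor of the Christoffel symbols of a warped product that depends on the fibre. -/
noncomputable def warpFiber (h : (κ → ℝ) → Matrix κ κ ℝ) :
    Unit ⊕ κ → Unit ⊕ κ → Unit ⊕ κ → (κ → ℝ) → ℝ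
  | Sum.inl _, Sum.inr i, Sum.inr j => fun y => h y i j
  | Sum.inr i, Sum.inl _, Sum.inr j => fun y => h y i j
  | Sum.inr i, Sum.inr j, Sum.inl _ => fun y => h y i j
  | Sum.inr i, Sum.inr j, Sum.inr k => christoffelLow h i j k
  | _, _, _ => fun _ => 1

/-- Each metric entry is a function of `t` times a function on the fibre, so a partial derivative
hits only one factor. Keeping this separated form makes the next derivative equally easy. -/
theorem christoffelLow_warp (hN : DifferentiableAt ℝ N (x (Sum.inl ()))) (hb : DifferentiableAt ℝ b (x (Sum.inl ())))
    (hh : ∀ i j, DifferentiableAt ℝ (fun y => h y i j) fun i => x (Sum.inr i))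
    (i j k : Unit ⊕ κ) :
    christoffelLow (warp N b h) i j k x
      = warpBase N b i j k (x (Sum.inl ())) * warpFiber h i j k fun i => x (Sum.inr i) := by
  have hb2 : DifferentiableAt ℝ (fun t => b t ^ 2) (x (Sum.inl ())) := hb.pow 2
  have hdb : deriv (fun t => b t ^ 2) (x (Sum.inl ()))
      = 2 * b (x (Sum.inl ())) * deriv b (x (Sum.inl ())) := by
    simpa using (hb.hasDerivAt.fun_pow 2).deriv
  have e00 : ∀ c u v, pd c (fun z => warp N b h z (Sum.inl u) (Sum.inl v)) x
      = pd c (fun z : Unit ⊕ κ → ℝ => N (z (Sum.inl ())) * (fun _ : κ → ℝ => (1 : ℝ))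
          fun i => z (Sum.inr i)) x := fun c u v => by simp [warp]
  have e01 : ∀ c u i, pd c (fun z => warp N b h z (Sum.inl u) (Sum.inr i)) x = 0 :=
    fun c u i => by simp [warp, pd]
  have e10 : ∀ c i u, pd c (fun z => warp N b h z (Sum.inr i) (Sum.inl u)) x = 0 :=
    fun c i u => by simp [warp, pd]
  have e11 : ∀ c i j, pd c (fun z => warp N b h z (Sum.inr i) (Sum.inr j)) x
      = pd c (fun z : Unit ⊕ κ → ℝ => (fun t => b t ^ 2) (z (Sum.inl ())) * (fun y => h y i j)
          fun i => z (Sum.inr i)) x := fun c i j => by simp [warp]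
  have f00 : ∀ u v w, pd (Sum.inl w) (fun z => warp N b h z (Sum.inl u) (Sum.inl v)) x
      = deriv N (x (Sum.inl ())) := fun u v w => by
    rw [e00, pd_inl_mul hN (differentiableAt_const _), mul_one]
  have g00 : ∀ u v k, pd (Sum.inr k) (fun z => warp N b h z (Sum.inl u) (Sum.inl v)) x
      = 0 := fun u v w => by
    rw [e00, pd_inr_mul hN (differentiableAt_const _)]
    simp [pd]
  have f11 : ∀ i j w, pd (Sum.inl w) (fun z => warp N b h z (Sum.inr i) (Sum.inr j)) x
      = 2 * b (x (Sum.inl ())) * deriv b (x (Sum.inl ())) * h (fun i => x (Sum.inr i)) i j :=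
    fun i j w => by rw [e11, pd_inl_mul hb2 (hh i j), hdb]
  have g11 : ∀ i j k, pd (Sum.inr k) (fun z => warp N b h z (Sum.inr i) (Sum.inr j)) x
      = b (x (Sum.inl ())) ^ 2 * pd k (fun y => h y i j) fun i => x (Sum.inr i) :=
    fun i j k => by rw [e11, pd_inr_mul hb2 (hh i j)]
  rcases i with i | i <;> rcases j with j | j <;> rcases k with k | k <;>
    simp only [christoffelLow, e01, e10, f00, g00, f11, g11, warpBase, warpFiber]
  all_goals ring

/-- The inverse metric is block diagonal, so base and fibre indices contract separately. -/
theorem christoffelSq_warp (hN : N (x (Sum.inl ())) ≠ 0) (hb : b (x (Sum.inl ())) ≠ 0)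
    (hd : (h fun i => x (Sum.inr i)).det ≠ 0) (i j k l : Unit ⊕ κ) :
    christoffelSq (warp N b h) i j k l x =
      (N (x (Sum.inl ())))⁻¹ * christoffelLow (warp N b h) i j (Sum.inl ()) x
        * christoffelLow (warp N b h) k l (Sum.inl ()) x
      + (b (x (Sum.inl ())) ^ 2)⁻¹ * ∑ p, ∑ q, invMetric h (fun i => x (Sum.inr i)) p q
        * christoffelLow (warp N b h) i j (Sum.inr q) x
        * christoffelLow (warp N b h) k l (Sum.inr p) x := by
  simp only [christoffelSq, invMetric, warp_inv hN hb hd, Fintype.sum_sum_type]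
  simp [Finset.mul_sum, mul_assoc]

theorem sum_invMetric_mul {g : (κ → ℝ) → Matrix κ κ ℝ} {y : κ → ℝ} (hs : ∀ y, (g y).IsSymm)
    (hd : (g y).det ≠ 0) (p i : κ) :
    ∑ q, invMetric g y p q * g y i q = if p = i then 1 else 0 := by
  simp only [fun q => (hs y).apply q i]
  rw [invMetric, ← Matrix.mul_apply, Matrix.nonsing_inv_mul _ (isUnit_iff_ne_zero.2 hd),
    Matrix.one_apply]

/-- With its mirror image and `sum_sum_invMetric_mul`, this evaluates the fibre sums of
`christoffelSq_warp`: a fibre Christoffel factor is either a row of the metric or a Christoffel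
symbol of `h`. -/
theorem sum_sum_invMetric_left {g : (κ → ℝ) → Matrix κ κ ℝ} {y : κ → ℝ}
    (hs : ∀ y, (g y).IsSymm) (hd : (g y).det ≠ 0) (i : κ) (c d : ℝ) (X : κ → ℝ) :
    ∑ p, ∑ q, invMetric g y p q * (c * g y i q) * (d * X p) = c * d * X i := by
  calc _ = ∑ p, c * d * X p * ∑ q, invMetric g y p q * g y i q := by
        simp only [Finset.mul_sum]
        exact Finset.sum_congr rfl fun p _ => Finset.sum_congr rfl fun q _ => by ring
    _ = _ := by simp [sum_invMetric_mul hs hd]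

theorem invMetric_symm {g : (κ → ℝ) → Matrix κ κ ℝ} {y : κ → ℝ} (hs : ∀ y, (g y).IsSymm)
    (p q : κ) : invMetric g y p q = invMetric g y q p := by
  have : ((g y)⁻¹).IsSymm := by rw [Matrix.IsSymm, Matrix.transpose_nonsing_inv, hs]
  exact this.apply q p

theorem sum_sum_invMetric_right {g : (κ → ℝ) → Matrix κ κ ℝ} {y : κ → ℝ}
    (hs : ∀ y, (g y).IsSymm) (hd : (g y).det ≠ 0) (i : κ) (c d : ℝ) (X : κ → ℝ) :
    ∑ p, ∑ q, invMetric g y p q * (d * X q) * (c * g y i p) = c * d * X i := by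
  rw [← sum_sum_invMetric_left hs hd i c d X, Finset.sum_comm]
  exact Finset.sum_congr rfl fun p _ => Finset.sum_congr rfl fun q _ => by
    rw [invMetric_symm hs q p]; ring

theorem sum_sum_invMetric_mul {g : (κ → ℝ) → Matrix κ κ ℝ} {y : κ → ℝ} (i j k l : κ) (c d : ℝ) :
    ∑ p, ∑ q, invMetric g y p q * (c * christoffelLow g i j q y) * (d * christoffelLow g k l p y)
      = c * d * christoffelSq g i j k l y := by
  simp only [christoffelSq, Finset.mul_sum]
  exact Finset.sum_congr rfl fun p _ => Finset.sum_congr rfl fun q _ => by ring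

end Warped

/-! ### Curvature of a warped product with fibre of constant curvature. -/

section WarpedCurvature

theorem _root_.ContDiffAt.differentiableAt_deriv {p : ℝ → ℝ} {t : ℝ} (hp : ContDiffAt ℝ 2 p t) :
    DifferentiableAt ℝ (deriv p) t :=
  ((hp.fderiv_right (m := 1) (by norm_num)).differentiableAt (by norm_num)).clm_apply
    (differentiableAt_const _)

theorem differentiableAt_warpBase {κ : Type*} {N b : ℝ → ℝ} {t : ℝ} (hN : ContDiffAt ℝ 2 N t) (hb : ContDiffAt ℝ 2 b t)
    (i j k : Unit ⊕ κ) : DifferentiableAt ℝ (warpBase N b i j k) t := by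
  have h1 := hN.differentiableAt_deriv
  have h2 := hb.differentiableAt_deriv
  have h3 : DifferentiableAt ℝ b t := hb.differentiableAt (by norm_num)
  rcases i with i | i <;> rcases j with j | j <;> rcases k with k | k <;>
    simp only [warpBase] <;> fun_prop

variable {κ : Type*} [Fintype κ] [DecidableEq κ]

variable {N b : ℝ → ℝ} {h : (κ → ℝ) → Matrix κ κ ℝ} {x : Unit ⊕ κ → ℝ}

theorem differentiableAt_warpFiber {y : κ → ℝ}
    (hh : ∀ i j, ContDiffAt ℝ 2 (fun y => h y i j) y) (i j k : Unit ⊕ κ) :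
    DifferentiableAt ℝ (warpFiber h i j k) y := by
  have h1 := fun i j => (hh i j).differentiableAt (by norm_num)
  rcases i with i | i <;> rcases j with j | j <;> rcases k with k | k <;>
    simp only [warpFiber]
  all_goals first
    | exact h1 _ _
    | exact differentiableAt_christoffelLow hh _ _ _
    | exact differentiableAt_const _

/-- The separated formula is needed on a neighbourhood, since it is differentiated next. -/
theorem christoffelLow_warp_eventuallyEq
    (hN : ContDiffAt ℝ 2 N (x (Sum.inl ()))) (hb : ContDiffAt ℝ 2 b (x (Sum.inl ())))
    (hh : ∀ i j, ContDiffAt ℝ 2 (fun y => h y i j) fun i => x (Sum.inr i))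
    (i j k : Unit ⊕ κ) :
    christoffelLow (warp N b h) i j k =ᶠ[𝓝 x] fun z =>
      warpBase N b i j k (z (Sum.inl ())) * warpFiber h i j k fun i => z (Sum.inr i) := by
  have hl : Tendsto (fun z : Unit ⊕ κ → ℝ => z (Sum.inl ())) (𝓝 x) (𝓝 (x (Sum.inl ()))) :=
    (continuous_apply _).tendsto x
  have hr : Tendsto (fun (z : Unit ⊕ κ → ℝ) (i : κ) => z (Sum.inr i)) (𝓝 x)
      (𝓝 fun i => x (Sum.inr i)) :=
    (continuous_pi fun i => continuous_apply (Sum.inr i)).tendsto x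
  have ev : ∀ {E : Type _} [NormedAddCommGroup E] [NormedSpace ℝ E] {f : E → ℝ} {a : E},
      ContDiffAt ℝ 2 f a → ∀ᶠ z in 𝓝 a, DifferentiableAt ℝ f z := fun hf =>
    (hf.eventually (by simp)).mono fun z hz => hz.differentiableAt (by norm_num)
  have hh' : ∀ᶠ z in 𝓝 x, ∀ i j, DifferentiableAt ℝ (fun y => h y i j) fun i => z (Sum.inr i) :=
    eventually_all.2 fun i => eventually_all.2 fun j => hr.eventually
      (((hh i j).eventually (by simp)).mono fun z hz => hz.differentiableAt (by norm_num))
  filter_upwards [hl.eventually (ev hN), hl.eventually (ev hb), hh'] with z h1 h2 h3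
  exact christoffelLow_warp h1 h2 h3 i j k

theorem pd_christoffelLow_warp_inl
    (hN : ContDiffAt ℝ 2 N (x (Sum.inl ()))) (hb : ContDiffAt ℝ 2 b (x (Sum.inl ())))
    (hh : ∀ i j, ContDiffAt ℝ 2 (fun y => h y i j) fun i => x (Sum.inr i))
    (u : Unit) (i j k : Unit ⊕ κ) :
    pd (Sum.inl u) (christoffelLow (warp N b h) i j k) x
      = deriv (warpBase N b i j k) (x (Sum.inl ())) * warpFiber h i j k fun i => x (Sum.inr i) := by
  rw [pd_congr _ (christoffelLow_warp_eventuallyEq hN hb hh i j k),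
    pd_inl_mul (differentiableAt_warpBase hN hb i j k) (differentiableAt_warpFiber hh i j k)]

theorem pd_christoffelLow_warp_inr
    (hN : ContDiffAt ℝ 2 N (x (Sum.inl ()))) (hb : ContDiffAt ℝ 2 b (x (Sum.inl ())))
    (hh : ∀ i j, ContDiffAt ℝ 2 (fun y => h y i j) fun i => x (Sum.inr i))
    (u : κ) (i j k : Unit ⊕ κ) :
    pd (Sum.inr u) (christoffelLow (warp N b h) i j k) x
      = warpBase N b i j k (x (Sum.inl ())) * pd u (warpFiber h i j k) fun i => x (Sum.inr i) := by
  rw [pd_congr _ (christoffelLow_warp_eventuallyEq hN hb hh i j k),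
    pd_inr_mul (differentiableAt_warpBase hN hb i j k) (differentiableAt_warpFiber hh i j k)]

/-- The tensor `α (g_ac g_bd - g_ad g_bc) + β (g_ac q_bd + q_ac g_bd - g_ad q_bc - q_ad g_bc)`. -/
def curvForm {ι R : Type*} [CommRing R] (α β : R) (g q : Matrix ι ι R) (a b c d : ι) : R :=
  α * (g a c * g b d - g a d * g b c)
    + β * (g a c * q b d + q a c * g b d - g a d * q b c - q a d * g b c)

/-- The curvature of a warped product over an interval whose fibre has constant curvature `K`. -/
theorem riemannLow_warp (hs : ∀ y, (h y).IsSymm)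
    (hN : ContDiffAt ℝ 2 N (x (Sum.inl ()))) (hb : ContDiffAt ℝ 2 b (x (Sum.inl ())))
    (hh : ∀ i j, ContDiffAt ℝ 2 (fun y => h y i j) fun i => x (Sum.inr i))
    (hN0 : N (x (Sum.inl ())) ≠ 0) (hb0 : b (x (Sum.inl ())) ≠ 0)
    (hd : (h fun i => x (Sum.inr i)).det ≠ 0) {K α β : ℝ}
    (hK : ∀ i j k l, riemannLow h i j k l (fun i => x (Sum.inr i))
      = curvForm K 0 (h fun i => x (Sum.inr i)) 0 i j k l)
    (hα : α = K / b (x (Sum.inl ())) ^ 2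
      - deriv b (x (Sum.inl ())) ^ 2 / (N (x (Sum.inl ())) * b (x (Sum.inl ())) ^ 2))
    (hβ : β = α + deriv (deriv b) (x (Sum.inl ())) / (b (x (Sum.inl ())) * N (x (Sum.inl ())))
      - deriv b (x (Sum.inl ())) * deriv N (x (Sum.inl ()))
        / (2 * N (x (Sum.inl ())) ^ 2 * b (x (Sum.inl ()))))
    (i j k l : Unit ⊕ κ) :
    riemannLow (warp N b h) i j k l x = curvForm α β (warp N b h x)
      (Matrix.fromBlocks (Matrix.of fun _ _ => -N (x (Sum.inl ()))) 0 0 0) i j k l := by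
  have hNd := hN.differentiableAt (by norm_num)
  have hbd : DifferentiableAt ℝ b (x (Sum.inl ())) := hb.differentiableAt (by norm_num)
  have hhd := fun i j => (hh i j).differentiableAt (by norm_num)
  have hdet : (warp N b h x).det ≠ 0 := by
    rw [warp_det]
    positivity
  have hd1 : deriv (fun t => b t * deriv b t) (x (Sum.inl ()))
      = deriv b (x (Sum.inl ())) ^ 2 + b (x (Sum.inl ())) * deriv (deriv b) (x (Sum.inl ())) := by
    rw [deriv_fun_mul hbd hb.differentiableAt_deriv]
    ring
  have hd2 : deriv (fun t => -(b t * deriv b t)) (x (Sum.inl ()))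
      = -(deriv b (x (Sum.inl ())) ^ 2
        + b (x (Sum.inl ())) * deriv (deriv b) (x (Sum.inl ()))) := by
    rw [deriv.fun_neg, hd1]
  have hd3 : deriv (fun t => b t ^ 2) (x (Sum.inl ()))
      = 2 * b (x (Sum.inl ())) * deriv b (x (Sum.inl ())) := by
    simpa using (hbd.hasDerivAt.fun_pow 2).deriv
  have hp0 : ∀ (u : κ) (y : κ → ℝ), pd u (fun _ : κ → ℝ => (1 : ℝ)) y = 0 := fun u y => by
    simp [pd]
  rw [riemannLow_eq (warp_isSymm hs) (warp_contDiffAt hN hb hh) hdet,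
    christoffelSq_warp hN0 hb0 hd, christoffelSq_warp hN0 hb0 hd]
  simp only [christoffelLow_warp hNd hbd hhd]
  have hR := fun i j k l => riemannLow_eq hs hh hd i j k l
  simp only [hK] at hR
  have hsy : ∀ i j, h (fun i => x (Sum.inr i)) i j = h (fun i => x (Sum.inr i)) j i :=
    fun i j => (hs _).apply j i
  -- Sixteen base/fibre index patterns. Only the all-fibre one involves the curvature of `h`; the
  -- final alternative below settles it with `hR`. The others need at most symmetry of `h` or of its
  -- Christoffel symbols.
  rcases i with i | i <;> rcases j with j | j <;> rcases k with k | k <;> rcases l with l | l <;>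
    simp only [pd_christoffelLow_warp_inl hN hb hh, pd_christoffelLow_warp_inr hN hb hh,
      warpBase, warpFiber, hd1, hd2, hd3, hp0, sum_sum_invMetric_left hs hd,
      sum_sum_invMetric_right hs hd, sum_sum_invMetric_mul, pd_metric hs, deriv_const,
      zero_mul, mul_zero, Finset.sum_const_zero, add_zero, zero_add, sub_zero, curvForm, warp,
      Matrix.fromBlocks_apply₁₁, Matrix.fromBlocks_apply₁₂, Matrix.fromBlocks_apply₂₁,
      Matrix.fromBlocks_apply₂₂, Matrix.of_apply, Matrix.zero_apply, Matrix.smul_apply, smul_eq_mul]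
  all_goals try simp only [hβ, hα]
  all_goals first
    | ring1
    | (field_simp; ring1)
    | (rw [hsy l j]; field_simp; ring1)
    | (rw [hsy l i]; field_simp; ring1)
    | (rw [hsy j i]; field_simp; ring1)
    | (rw [christoffelLow_symm hs j i]; field_simp; ring1)
    | (have e := hR i j k l
       simp only [curvForm, Matrix.zero_apply] at e
       field_simp
       linear_combination (-N (x (Sum.inl ()))) * e)

end WarpedCurvature

/-! ### Ricci tensor, scalar curvature, `K2` and `K3` of a curvature of the form `curvForm`. -/

section CurvFormTraces

variable {ι : Type*} [Fintype ι] [DecidableEq ι] {g : (ι → ℝ) → Matrix ι ι ℝ} {x : ι → ℝ}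

theorem ricci_eq_sum_riemannLow (hd : (g x).det ≠ 0) (a b : ι) :
    ricci g a b x = ∑ d, ∑ e, riemannLow g a d b e x * (g x)⁻¹ e d := by
  have h1 : g x * (g x)⁻¹ = 1 := Matrix.mul_nonsing_inv _ (isUnit_iff_ne_zero.2 hd)
  refine Finset.sum_congr rfl fun d _ => ?_
  simp only [riemannLow, Finset.sum_mul]
  rw [Finset.sum_comm]
  simp only [mul_assoc, ← Finset.mul_sum, ← Matrix.mul_apply, h1, Matrix.one_apply]
  simp

variable {α β : ℝ} {q : Matrix ι ι ℝ}

/-- Each term is a product of two bilinear forms. Contraction yields either a trace (`D` for `g`,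
`-1` for `q`) or a matrix product through `g⁻¹`, which returns `g` or `q`. -/
theorem ricci_of_curvForm (hd : (g x).det ≠ 0) (hq : (q * (g x)⁻¹).trace = -1)
    (hR : ∀ a b c d, riemannLow g a b c d x = curvForm α β (g x) q a b c d) (a b : ι) :
    ricci g a b x = (α * (Fintype.card ι - 1) - β) * g x a b + β * (Fintype.card ι - 2) * q a b := by
  have hu := isUnit_iff_ne_zero.2 hd
  have contr1 : ∀ A B : Matrix ι ι ℝ, ∑ d, ∑ e, A a b * B d e * (g x)⁻¹ e d
      = A a b * (B * (g x)⁻¹).trace := fun A B => by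
    simp only [Matrix.trace, Matrix.diag, Matrix.mul_apply, Finset.mul_sum, mul_assoc]
  have contr2 : ∀ A B : Matrix ι ι ℝ, ∑ d, ∑ e, A a e * B d b * (g x)⁻¹ e d
      = (A * (g x)⁻¹ * B) a b := fun A B => by
    simp only [Matrix.mul_apply, Finset.sum_mul]
    exact Finset.sum_congr rfl fun _ _ => Finset.sum_congr rfl fun _ _ => by ring
  rw [ricci_eq_sum_riemannLow hd]
  simp only [hR]
  calc _ = α * ((∑ d, ∑ e, g x a b * g x d e * (g x)⁻¹ e d)
          - ∑ d, ∑ e, g x a e * g x d b * (g x)⁻¹ e d)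
        + β * ((∑ d, ∑ e, g x a b * q d e * (g x)⁻¹ e d)
          + (∑ d, ∑ e, q a b * g x d e * (g x)⁻¹ e d)
          - (∑ d, ∑ e, g x a e * q d b * (g x)⁻¹ e d)
          - ∑ d, ∑ e, q a e * g x d b * (g x)⁻¹ e d) := by
        simp only [← Finset.sum_sub_distrib, ← Finset.sum_add_distrib, Finset.mul_sum]
        exact Finset.sum_congr rfl fun _ _ => Finset.sum_congr rfl fun _ _ => by
          rw [curvForm]; ring
    _ = _ := by
        rw [contr1, contr1, contr1, contr2, contr2, contr2, hq, Matrix.mul_nonsing_inv _ hu,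
          Matrix.mul_assoc q, Matrix.nonsing_inv_mul _ hu, Matrix.one_mul, Matrix.one_mul,
          Matrix.mul_one, Matrix.trace_one]
        ring

theorem scalarCurv_of_curvForm (hs : ∀ y, (g y).IsSymm) (hd : (g x).det ≠ 0)
    (hq : (q * (g x)⁻¹).trace = -1)
    (hR : ∀ a b c d, riemannLow g a b c d x = curvForm α β (g x) q a b c d) :
    scalarCurv g x = Fintype.card ι * (Fintype.card ι - 1) * α
      - 2 * (Fintype.card ι - 1) * β := by
  have contr : ∀ A : Matrix ι ι ℝ, ∑ a, ∑ b, invMetric g x a b * A a b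
      = (A * (g x)⁻¹).trace := fun A => by
    simp only [Matrix.trace, Matrix.diag, Matrix.mul_apply]
    exact Finset.sum_congr rfl fun a _ => Finset.sum_congr rfl fun b _ => by
      rw [invMetric_symm hs, invMetric, mul_comm]
  calc scalarCurv g x
      = (α * (Fintype.card ι - 1) - β) * ∑ a, ∑ b, invMetric g x a b * g x a b
        + β * (Fintype.card ι - 2) * ∑ a, ∑ b, invMetric g x a b * q a b := by
        simp only [scalarCurv, ricci_of_curvForm hd hq hR, Finset.mul_sum,
          ← Finset.sum_add_distrib]
        exact Finset.sum_congr rfl fun _ _ => Finset.sum_congr rfl fun _ _ => by ring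
    _ = _ := by
        rw [contr, contr, hq, Matrix.mul_nonsing_inv _ (isUnit_iff_ne_zero.2 hd), Matrix.trace_one]
        ring

variable [Nonempty ι]

theorem tracelessRicci_of_curvForm (hs : ∀ y, (g y).IsSymm) (hd : (g x).det ≠ 0)
    (hq : (q * (g x)⁻¹).trace = -1)
    (hR : ∀ a b c d, riemannLow g a b c d x = curvForm α β (g x) q a b c d) {Γ : ℝ}
    (hΓ : Γ = β * (Fintype.card ι - 2) / Fintype.card ι) (a b : ι) :
    tracelessRicci g a b x = (Γ • (g x + (Fintype.card ι : ℝ) • q)) a b := by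
  have hD : (Fintype.card ι : ℝ) ≠ 0 := by simp
  simp only [tracelessRicci, ricci_of_curvForm hd hq hR, scalarCurv_of_curvForm hs hd hq hR,
    Matrix.smul_apply, Matrix.add_apply, smul_eq_mul, hΓ]
  field_simp
  ring

theorem tracelessRicciMixed_of_curvForm (hs : ∀ y, (g y).IsSymm) (hd : (g x).det ≠ 0)
    (hq : (q * (g x)⁻¹).trace = -1)
    (hR : ∀ a b c d, riemannLow g a b c d x = curvForm α β (g x) q a b c d) {Γ : ℝ}
    (hΓ : Γ = β * (Fintype.card ι - 2) / Fintype.card ι) (a b : ι) :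
    tracelessRicciMixed g a b x
      = (Γ • (1 + (Fintype.card ι : ℝ) • (q * (g x)⁻¹))) a b := by
  simp only [tracelessRicciMixed, tracelessRicci_of_curvForm hs hd hq hR hΓ, invMetric]
  rw [← Matrix.mul_apply, Matrix.smul_mul, Matrix.add_mul, Matrix.smul_mul,
    Matrix.mul_nonsing_inv _ (isUnit_iff_ne_zero.2 hd)]

/-- Since `-P` is idempotent of trace one, `1 + D P` has eigenvalue `1` with multiplicity `D - 1`
and `1 - D` once. The squares sum to `D (D - 1)`, the normalising factor. -/
theorem K2_of_curvForm (hs : ∀ y, (g y).IsSymm) (hd : (g x).det ≠ 0)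
    (hD : 2 < Fintype.card ι) (hqs : q.IsSymm) (hq : (q * (g x)⁻¹).trace = -1)
    (hqq : q * (g x)⁻¹ * (q * (g x)⁻¹) = -(q * (g x)⁻¹))
    (hR : ∀ a b c d, riemannLow g a b c d x = curvForm α β (g x) q a b c d) {Γ : ℝ}
    (hΓ : Γ = β * (Fintype.card ι - 2) / Fintype.card ι) : K2 g x = Γ ^ 2 := by
  set P := q * (g x)⁻¹ with hP
  set D : ℝ := (Fintype.card ι : ℝ) with hDdef
  have hD' : (2 : ℝ) < D := by
    rw [hDdef]
    exact_mod_cast hD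
  have hginv : ((g x)⁻¹).IsSymm := by rw [Matrix.IsSymm, Matrix.transpose_nonsing_inv, hs]
  set Z := Γ • (g x + D • q) with hZ
  have hZs : Z.IsSymm := ((hs x).add (hqs.smul D)).smul Γ
  have hZg : Z * (g x)⁻¹ = Γ • (1 + D • P) := by
    rw [hZ, Matrix.smul_mul, Matrix.add_mul, Matrix.smul_mul,
      Matrix.mul_nonsing_inv _ (isUnit_iff_ne_zero.2 hd)]
  have hup : ∀ a b, tracelessRicciUp g a b x = ((g x)⁻¹ * (Z * (g x)⁻¹)) a b := fun a b => by
    simp only [tracelessRicciUp, tracelessRicciMixed_of_curvForm hs hd hq hR hΓ, invMetric]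
    rw [← Matrix.mul_apply, hZg]
  have hups : ((g x)⁻¹ * (Z * (g x)⁻¹)).IsSymm := by
    rw [Matrix.IsSymm, Matrix.transpose_mul, Matrix.transpose_mul, hginv, hZs, Matrix.mul_assoc]
  have hsum : ∑ a, ∑ b, tracelessRicci g a b x * tracelessRicciUp g a b x
      = (Z * (g x)⁻¹ * (Z * (g x)⁻¹)).trace := by
    simp only [tracelessRicci_of_curvForm hs hd hq hR hΓ, hup]
    rw [Matrix.mul_assoc, Matrix.trace]
    refine Finset.sum_congr rfl fun a _ => ?_
    rw [Matrix.diag, Matrix.mul_apply]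
    exact Finset.sum_congr rfl fun b _ => by rw [hups.apply]
  have htr : (Z * (g x)⁻¹ * (Z * (g x)⁻¹)).trace = Γ ^ 2 * (D * (D - 1)) := by
    have : Z * (g x)⁻¹ * (Z * (g x)⁻¹) = Γ ^ 2 • (1 + (2 * D - D ^ 2) • P) := by
      rw [hZg]
      simp only [Matrix.smul_mul, Matrix.mul_smul, add_mul, mul_add, hqq, one_mul, mul_one]
      module
    rw [this, Matrix.trace_smul, Matrix.trace_add, Matrix.trace_smul, hq, Matrix.trace_one]
    simp only [smul_eq_mul, ← hDdef]
    ring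
  rw [K2, hsum, htr, ← hDdef]
  have h1 : D - 1 ≠ 0 := by linarith
  have h2 : D ≠ 0 := by linarith
  field_simp

/-- The cubes of the same eigenvalues sum to `(D - 1) - (D - 1)³ = -D (D - 1) (D - 2)`, which
explains the sign in `K3`. -/
theorem K3_of_curvForm (hs : ∀ y, (g y).IsSymm) (hd : (g x).det ≠ 0)
    (hD : 2 < Fintype.card ι) (hq : (q * (g x)⁻¹).trace = -1)
    (hqq : q * (g x)⁻¹ * (q * (g x)⁻¹) = -(q * (g x)⁻¹))
    (hR : ∀ a b c d, riemannLow g a b c d x = curvForm α β (g x) q a b c d) {Γ : ℝ}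
    (hΓ : Γ = β * (Fintype.card ι - 2) / Fintype.card ι) : K3 g x = Γ ^ 3 := by
  set P := q * (g x)⁻¹ with hP
  set D : ℝ := (Fintype.card ι : ℝ) with hDdef
  have hD' : (2 : ℝ) < D := by
    rw [hDdef]
    exact_mod_cast hD
  set Z := Γ • (g x + D • q) with hZ
  have hZg : Z * (g x)⁻¹ = Γ • (1 + D • P) := by
    rw [hZ, Matrix.smul_mul, Matrix.add_mul, Matrix.smul_mul,
      Matrix.mul_nonsing_inv _ (isUnit_iff_ne_zero.2 hd)]
  have hmix := tracelessRicciMixed_of_curvForm hs hd hq hR hΓ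
  simp only [← hP, ← hDdef, ← hZg] at hmix
  have hup : ∀ a b, tracelessRicciUp g a b x = ((g x)⁻¹ * (Z * (g x)⁻¹)) a b := fun a b => by
    simp only [tracelessRicciUp, hmix, invMetric]
    rw [← Matrix.mul_apply]
  have hsum : ∑ a, ∑ b, ∑ c, tracelessRicci g a b x * tracelessRicciUp g b c x
      * tracelessRicciMixed g c a x
      = (Z * (g x)⁻¹ * (Z * (g x)⁻¹) * (Z * (g x)⁻¹)).trace := by
    simp only [tracelessRicci_of_curvForm hs hd hq hR hΓ, hup, hmix]
    rw [Matrix.mul_assoc Z, Matrix.trace]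
    refine Finset.sum_congr rfl fun a _ => ?_
    rw [Matrix.diag, Matrix.mul_apply, Finset.sum_comm]
    refine Finset.sum_congr rfl fun c _ => ?_
    rw [← Finset.sum_mul, ← Matrix.mul_apply]
  have htr : (Z * (g x)⁻¹ * (Z * (g x)⁻¹) * (Z * (g x)⁻¹)).trace
      = -(Γ ^ 3 * (D * (D - 1) * (D - 2))) := by
    have : Z * (g x)⁻¹ * (Z * (g x)⁻¹) * (Z * (g x)⁻¹)
        = Γ ^ 3 • (1 + (3 * D - 3 * D ^ 2 + D ^ 3) • P) := by
      rw [hZg]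
      simp only [Matrix.smul_mul, Matrix.mul_smul, add_mul, mul_add, hqq, one_mul, mul_one,
        neg_mul, smul_neg]
      module
    rw [this, Matrix.trace_smul, Matrix.trace_add, Matrix.trace_smul, hq, Matrix.trace_one]
    simp only [smul_eq_mul, ← hDdef]
    ring
  rw [K3, hsum, htr, ← hDdef]
  have h1 : D - 1 ≠ 0 := by linarith
  have h2 : D ≠ 0 := by linarith
  have h3 : D - 2 ≠ 0 := by linarith
  field_simp

end CurvFormTraces

/-! ### Algebra of complete contractions over a commutative ring. -/

section FullContraction

/-- `curvForm` as a function of the four indices. -/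
def curvTensor {ι R : Type*} [CommRing R] (α β : R) (g q : Matrix ι ι R) (u : Fin 4 → ι) : R :=
  curvForm α β g q (u 0) (u 1) (u 2) (u 3)

theorem curvTensor_comp {ι R : Type*} [CommRing R] (α β : R) {g q g' q' : Matrix ι ι R}
    (σ : ι → ι) (hg : ∀ c d, g (σ c) (σ d) = g' c d) (hq : ∀ c d, q (σ c) (σ d) = q' c d)
    (u : Fin 4 → ι) : curvTensor α β g q (σ ∘ u) = curvTensor α β g' q' u := by
  simp only [curvTensor, curvForm, Function.comp_apply, hg, hq]

variable {ι : Type*} [Fintype ι] {R : Type*} [CommRing R] {n : ℕ}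

/-- The complete contraction along `e` of the `n` tensors `T i` of rank four with the inverse
metric `G`. -/
def fullContraction (e : Pattern n) (T : Fin n → (Fin 4 → ι) → R) (G : Matrix ι ι R) : R :=
  ∑ v : Fin n × Fin 4 → ι, (∏ i, T i fun s => v (i, s)) *
    ∏ j, G (v (e.symm (j, 0))) (v (e.symm (j, 1)))

/-- Reindexing the slots by the pairs of `e` makes the sum factor over pairs; each pair contributes
one entry of `Eᵀ G E`. -/
theorem sum_prod_frame_mul (e : Pattern n) (E G : Matrix ι ι R) (W : Fin n × Fin 4 → ι) :
    ∑ v : Fin n × Fin 4 → ι, (∏ p, E (v p) (W p)) *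
        ∏ j, G (v (e.symm (j, 0))) (v (e.symm (j, 1)))
      = ∏ j, (E.transpose * G * E) (W (e.symm (j, 0))) (W (e.symm (j, 1))) := by
  classical
  have hE : ∀ a b, (E.transpose * G * E) a b
      = ∑ u : Fin 2 → ι, E (u 0) a * E (u 1) b * G (u 0) (u 1) := fun a b => by
    rw [← (finTwoArrowEquiv ι).symm.sum_comp, Fintype.sum_prod_type_right]
    simp only [Matrix.mul_apply, Matrix.transpose_apply, Finset.sum_mul]
    exact Finset.sum_congr rfl fun _ _ => Finset.sum_congr rfl fun _ _ => by simp; ring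
  simp only [hE, Finset.prod_univ_sum, Fintype.piFinset_univ]
  rw [← (Equiv.curry (Fin (2 * n)) (Fin 2) ι).sum_comp,
    ← (Equiv.arrowCongr e (Equiv.refl ι)).symm.sum_comp]
  refine Finset.sum_congr rfl fun u _ => ?_
  rw [← e.symm.prod_comp, Fintype.prod_prod_type, ← Finset.prod_mul_distrib]
  refine Finset.prod_congr rfl fun j _ => ?_
  simp [Fin.prod_univ_two, Equiv.arrowCongr]

theorem fullContraction_frame (e : Pattern n) (T : Fin n → (Fin 4 → ι) → R)
    (E G : Matrix ι ι R) :
    fullContraction e (fun i u => ∑ w : Fin 4 → ι, (∏ s, E (u s) (w s)) * T i w) G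
      = fullContraction e T (E.transpose * G * E) := by
  classical
  simp only [fullContraction, ← sum_prod_frame_mul, Finset.prod_univ_sum, Fintype.piFinset_univ,
    Finset.mul_sum, Finset.sum_mul]
  rw [Finset.sum_comm, ← (Equiv.curry (Fin n) (Fin 4) ι).sum_comp]
  refine Finset.sum_congr rfl fun W _ => Finset.sum_congr rfl fun v _ => ?_
  have hW : ∀ i, Equiv.curry (Fin n) (Fin 4) ι W i = fun s => W (i, s) := fun _ => rfl
  simp only [Finset.prod_mul_distrib, Fintype.prod_prod_type, hW]
  ring

/-- Multilinear expansion, with `S` the set of factors in which `B` is chosen. -/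
theorem fullContraction_smul_add (e : Pattern n) (A B : (Fin 4 → ι) → R) (X Y : R)
    (G : Matrix ι ι R) :
    fullContraction e (fun _ u => Y * B u + X * A u) G
      = ∑ S : Finset (Fin n), Y ^ S.card * X ^ (n - S.card)
        * fullContraction e (fun i => if i ∈ S then B else A) G := by
  classical
  simp only [fullContraction, Finset.mul_sum]
  rw [Finset.sum_comm]
  refine Finset.sum_congr rfl fun v _ => ?_
  rw [Finset.prod_add, Finset.sum_mul, Finset.powerset_univ]
  refine Finset.sum_congr rfl fun S _ => ?_
  have h1 : ∏ i, (if i ∈ S then B else A) (fun s => v (i, s))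
      = (∏ i ∈ S, B fun s => v (i, s)) * ∏ i ∈ Finset.univ \ S, A fun s => v (i, s) := by
    rw [← Finset.prod_sdiff (Finset.subset_univ S), mul_comm]
    congr 1
    · exact Finset.prod_congr rfl fun i hi => by rw [if_pos hi]
    · exact Finset.prod_congr rfl fun i hi => by rw [if_neg (Finset.mem_sdiff.1 hi).2]
  rw [h1, Finset.prod_mul_distrib, Finset.prod_mul_distrib, Finset.prod_const, Finset.prod_const,
    Finset.card_sdiff_of_subset (Finset.subset_univ S), Finset.card_univ, Fintype.card_fin]
  ring

theorem map_fullContraction {R' : Type*} [CommRing R'] (f : R →+* R') (e : Pattern n)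
    (T : Fin n → (Fin 4 → ι) → R) (G : Matrix ι ι R) :
    f (fullContraction e T G) = fullContraction e (fun i u => f (T i u)) (G.map f) := by
  simp [fullContraction]

theorem fullContraction_update_sum (e : Pattern n) (T : Fin n → (Fin 4 → ι) → R)
    (G : Matrix ι ι R) (i : Fin n) {κ : Type*} [Fintype κ] (z : κ → R)
    (B : κ → (Fin 4 → ι) → R) :
    fullContraction e (Function.update T i fun u => ∑ a, z a * B a u) G
      = ∑ a, z a * fullContraction e (Function.update T i (B a)) G := by
  have h : ∀ (C : (Fin 4 → ι) → R) (v : Fin n × Fin 4 → ι),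
      ∏ j, Function.update T i C j (fun s => v (j, s)) = C (fun s => v (i, s)) *
        ∏ j ∈ Finset.univ.erase i, T j fun s => v (j, s) := fun C v => by
    rw [← Finset.mul_prod_erase _ _ (Finset.mem_univ i), Function.update_self]
    congr 1
    exact Finset.prod_congr rfl fun j hj => by rw [Function.update_of_ne (Finset.ne_of_mem_erase hj)]
  simp only [fullContraction, h, Finset.sum_mul, Finset.mul_sum]
  rw [Finset.sum_comm]
  exact Finset.sum_congr rfl fun _ _ => Finset.sum_congr rfl fun _ _ => by ring

variable [DecidableEq ι]

theorem fullContraction_perm (e : Pattern n) (T : Fin n → (Fin 4 → ι) → R) (σ : Equiv.Perm ι) :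
    fullContraction e (fun i u => T i (σ ∘ u)) 1 = fullContraction e T (1 : Matrix ι ι R) := by
  rw [fullContraction, fullContraction]
  symm
  rw [← (Equiv.arrowCongr (Equiv.refl (Fin n × Fin 4)) σ).sum_comp]
  refine Finset.sum_congr rfl fun v _ => ?_
  simp only [Equiv.arrowCongr_apply, Equiv.coe_refl, Equiv.refl_symm, Function.comp_id,
    Function.comp_apply, Matrix.one_apply, σ.apply_eq_iff_eq]
  rfl

/-- A complete contraction that is linear in the trace-free part of the Ricci tensor vanishes. -/
theorem fullContraction_linear_eq_zero (e : Pattern n) (i : Fin n) (α β : R) (z : ι → R)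
    (hz : ∑ a, z a = 0) :
    fullContraction e (Function.update (fun _ => curvTensor α 0 1 0) i
      (curvTensor 0 β 1 (Matrix.diagonal z))) (1 : Matrix ι ι R) = 0 := by
  -- The tensor is linear in `z`, so it splits along the coordinate projections.
  have hlin : curvTensor 0 β 1 (Matrix.diagonal z) = fun u : Fin 4 → ι =>
      ∑ a, z a * curvTensor 0 β 1 (Matrix.diagonal (Pi.single a 1)) u := by
    funext u
    have hd : ∀ b c, Matrix.diagonal z b c
        = ∑ a, z a * Matrix.diagonal (Pi.single a (1 : R)) b c := fun b c => by
      by_cases h : b = c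
      · subst h
        simp [Pi.single_apply]
      · simp [h]
    simp only [curvTensor, curvForm, hd]
    simp only [Finset.mul_sum, Finset.sum_mul, ← Finset.sum_add_distrib, ← Finset.sum_sub_distrib,
      zero_mul, zero_add]
    exact Finset.sum_congr rfl fun _ _ => by ring
  -- Swapping two frame vectors preserves the identity metric and exchanges their projections. All
  -- projections thus contribute one common value, and the total is that value times `∑ z = 0`.
  have hperm : ∀ a b : ι, fullContraction e (Function.update (fun _ => curvTensor α 0 1 0) i
        (curvTensor 0 β 1 (Matrix.diagonal (Pi.single a 1)))) (1 : Matrix ι ι R)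
      = fullContraction e (Function.update (fun _ => curvTensor α 0 1 0) i
        (curvTensor 0 β 1 (Matrix.diagonal (Pi.single b 1)))) 1 := fun a b => by
    rw [← fullContraction_perm e _ (Equiv.swap a b)]
    congr 1
    funext j u
    have hone : ∀ c d, (1 : Matrix ι ι R) (Equiv.swap a b c) (Equiv.swap a b d)
        = (1 : Matrix ι ι R) c d := fun c d => by simp [Matrix.one_apply]
    have hdiag : ∀ c d, Matrix.diagonal (Pi.single a (1 : R)) (Equiv.swap a b c)
        (Equiv.swap a b d) = Matrix.diagonal (Pi.single b (1 : R)) c d := fun c d => by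
      simp only [Matrix.diagonal_apply, (Equiv.swap a b).apply_eq_iff_eq, Pi.single_apply,
        Equiv.swap_apply_eq_iff, Equiv.swap_apply_left]
    by_cases hj : j = i
    · subst hj
      rw [Function.update_self, Function.update_self, curvTensor_comp _ _ _ hone hdiag]
    · rw [Function.update_of_ne hj, Function.update_of_ne hj,
        curvTensor_comp (q' := 0) _ _ _ hone fun _ _ => rfl]
  rw [hlin, fullContraction_update_sum]
  rcases isEmpty_or_nonempty ι with h | ⟨⟨b⟩⟩
  · simp
  · rw [Finset.sum_congr rfl fun a _ => by rw [hperm a b], ← Finset.sum_mul, hz, zero_mul]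

/-- Tensoriality under the frame `E`, checked on the two index pairings `(02)(13)` and `(03)(12)`
that make up `curvForm`. -/
theorem curvTensor_frame (α β : R) (E q : Matrix ι ι R) (u : Fin 4 → ι) :
    curvTensor α β (E * E.transpose) (E * q * E.transpose) u
      = ∑ w : Fin 4 → ι, (∏ s, E (u s) (w s)) * curvTensor α β 1 q w := by
  have hsum : ∀ f : (Fin 4 → ι) → R, ∑ w, f w = ∑ a, ∑ b, ∑ c, ∑ d, f ![a, b, c, d] := fun f => by
    rw [← (Fin.consEquiv fun _ : Fin 4 => ι).sum_comp, Fintype.sum_prod_type]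
    refine Finset.sum_congr rfl fun a _ => ?_
    rw [← (Fin.consEquiv fun _ : Fin 3 => ι).sum_comp, Fintype.sum_prod_type]
    refine Finset.sum_congr rfl fun b _ => ?_
    rw [← (finTwoArrowEquiv ι).symm.sum_comp, Fintype.sum_prod_type]
    rfl
  have hE : ∀ (X : Matrix ι ι R) a c, (E * X * E.transpose) a c
      = ∑ p, ∑ r, E a p * E c r * X p r := fun X a c => by
    rw [Finset.sum_comm]
    simp only [Matrix.mul_apply, Matrix.transpose_apply, Finset.sum_mul]
    exact Finset.sum_congr rfl fun _ _ => Finset.sum_congr rfl fun _ _ => by ring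
  have hX : ∀ (X Y : Matrix ι ι R), (E * X * E.transpose) (u 0) (u 2)
        * (E * Y * E.transpose) (u 1) (u 3)
      = ∑ w : Fin 4 → ι, (∏ s, E (u s) (w s)) * (X (w 0) (w 2) * Y (w 1) (w 3)) := fun X Y => by
    rw [hsum, hE, hE, Finset.sum_mul_sum]
    refine Finset.sum_congr rfl fun p _ => Finset.sum_congr rfl fun q _ => ?_
    rw [Finset.sum_mul_sum]
    refine Finset.sum_congr rfl fun r _ => Finset.sum_congr rfl fun s _ => ?_
    simp [Fin.prod_univ_four]
    ring
  have hY : ∀ (X Y : Matrix ι ι R), (E * X * E.transpose) (u 0) (u 3)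
        * (E * Y * E.transpose) (u 1) (u 2)
      = ∑ w : Fin 4 → ι, (∏ s, E (u s) (w s)) * (X (w 0) (w 3) * Y (w 1) (w 2)) := fun X Y => by
    rw [hsum, hE, hE, Finset.sum_mul_sum]
    refine Finset.sum_congr rfl fun p _ => Finset.sum_congr rfl fun q _ => ?_
    rw [mul_comm, Finset.sum_mul_sum]
    refine Finset.sum_congr rfl fun r _ => Finset.sum_congr rfl fun s _ => ?_
    simp [Fin.prod_univ_four]
    ring
  have h1 : E * E.transpose = E * 1 * E.transpose := by rw [Matrix.mul_one]
  rw [curvTensor, curvForm, h1, hX, hX, hX, hY, hY, hY]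
  simp only [Finset.mul_sum, ← Finset.sum_add_distrib, ← Finset.sum_sub_distrib]
  exact Finset.sum_congr rfl fun _ _ => by rw [curvTensor, curvForm]; ring

end FullContraction

/-! ### Orthonormal frames. -/

section Frames

/-- A square root of `N` and a frame of the fibre give a frame of the warped product. Over `ℂ`, with
transpose rather than adjoint, `N` may be negative, so Lorentzian signature needs no separate
treatment. -/
theorem warp_map_eq_mul_transpose {κ : Type*} [Fintype κ] {N b : ℝ → ℝ}
    {h : (κ → ℝ) → Matrix κ κ ℝ} {x : Unit ⊕ κ → ℝ} {ν : ℂ} {E : Matrix κ κ ℂ}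
    (hν : ν * ν = N (x (Sum.inl ())))
    (hE : E * E.transpose = (h fun i => x (Sum.inr i)).map Complex.ofReal) :
    Matrix.fromBlocks (Matrix.of fun _ _ : Unit => ν) 0 0 ((b (x (Sum.inl ())) : ℂ) • E)
      * (Matrix.fromBlocks (Matrix.of fun _ _ : Unit => ν) 0 0
          ((b (x (Sum.inl ())) : ℂ) • E)).transpose
      = (warp N b h x).map Complex.ofReal := by
  rw [warp, Matrix.fromBlocks_transpose, Matrix.fromBlocks_multiply, Matrix.fromBlocks_map]
  congr 1
  · ext
    simp [Matrix.mul_apply, hν]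
  · ext; simp
  · ext; simp
  · ext i j
    have := congr_fun (congr_fun hE i) j
    simp only [Matrix.map_apply] at this
    simp only [Matrix.mul_zero, Matrix.transpose_zero, Matrix.transpose_smul, Matrix.smul_mul,
      Matrix.mul_smul, zero_add, Matrix.smul_apply, Matrix.map_apply, smul_eq_mul, this]
    push_cast
    ring

open scoped MatrixOrder in
theorem exists_eq_mul_transpose_of_posSemidef {m : ℕ} {A : Matrix (Fin m) (Fin m) ℝ}
    (hA : A.PosSemidef) : ∃ Q : Matrix (Fin m) (Fin m) ℝ, A = Q * Q.transpose := by
  obtain ⟨Q, hQ⟩ := CStarAlgebra.nonneg_iff_eq_mul_star_self.1 hA.nonneg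
  refine ⟨Q, ?_⟩
  rwa [Matrix.star_eq_conjTranspose, Matrix.conjTranspose_eq_transpose_of_trivial] at hQ

end Frames

/-! ### FLRW metrics as iterated warped products; the spatial metric. -/

section FLRW

variable {m : ℕ} {k : ℝ} {a F : ℝ → ℝ} {I : Set ℝ}
  {ψ : (Fin m → ℝ) → EuclideanSpace ℝ (Fin (m + 1))} {U : Set (Fin m → ℝ)} {x : Idx m → ℝ}

/-- The spatial metric `dr² / (1 - k r²) + r² dΩ²`. -/
noncomputable def spaceMetric (k : ℝ) (ψ : (Fin m → ℝ) → EuclideanSpace ℝ (Fin (m + 1))) :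
    (Unit ⊕ Fin m → ℝ) → Matrix (Unit ⊕ Fin m) (Unit ⊕ Fin m) ℝ :=
  warp (fun r => 1 / (1 - k * r ^ 2)) id (roundMetric ψ)

theorem flrwMetric_eq_warp (k : ℝ) (a F : ℝ → ℝ)
    (ψ : (Fin m → ℝ) → EuclideanSpace ℝ (Fin (m + 1))) :
    flrwMetric k a F ψ = warp (fun t => -F t) a (spaceMetric k ψ) := by
  funext x
  ext p q
  rcases p with p | p | p <;> rcases q with q | q | q <;>
    simp [flrwMetric, warp, spaceMetric, tOf, rOf, div_eq_mul_inv, mul_assoc]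
  exact Or.inl (Or.inl rfl)

theorem spaceMetric_isSymm (k : ℝ) (ψ : (Fin m → ℝ) → EuclideanSpace ℝ (Fin (m + 1)))
    (y : Unit ⊕ Fin m → ℝ) : (spaceMetric k ψ y).IsSymm :=
  warp_isSymm (roundMetric_isSymm ψ) y

section Space

variable {y : Unit ⊕ Fin m → ℝ}

theorem contDiffAt_one_div_one_sub {r : ℝ} (hk : 0 < 1 - k * r ^ 2) :
    ContDiffAt ℝ 2 (fun r : ℝ => 1 / (1 - k * r ^ 2)) r := by
  refine ContDiffAt.div contDiffAt_const ?_ hk.ne'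
  fun_prop

theorem spaceMetric_contDiffAt (hψ : IsSphereParam ψ U) (hk : 0 < 1 - k * y (Sum.inl ()) ^ 2)
    (hU : (fun i => y (Sum.inr i)) ∈ U) (i j : Unit ⊕ Fin m) :
    ContDiffAt ℝ 2 (fun z => spaceMetric k ψ z i j) y :=
  warp_contDiffAt (contDiffAt_one_div_one_sub hk) contDiffAt_id (hψ.roundMetric_contDiffAt hU) i j

theorem spaceMetric_det (hψ : IsSphereParam ψ U) (hr : 0 < y (Sum.inl ()))
    (hk : 0 < 1 - k * y (Sum.inl ()) ^ 2) (hU : (fun i => y (Sum.inr i)) ∈ U) :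
    (spaceMetric k ψ y).det ≠ 0 := by
  rw [spaceMetric, warp_det]
  have := (hψ.roundMetric_posDef hU).det_pos
  positivity

/-- First use of `riemannLow_warp`: for `N = 1 / (1 - k r²)`, `b = r` and sphere curvature `K = 1`,
the formulas evaluate to `α = k` and `β = 0`. -/
theorem riemannLow_spaceMetric (hψ : IsSphereParam ψ U) (hr : 0 < y (Sum.inl ()))
    (hk : 0 < 1 - k * y (Sum.inl ()) ^ 2) (hU : (fun i => y (Sum.inr i)) ∈ U)
    (i j l n : Unit ⊕ Fin m) :
    riemannLow (spaceMetric k ψ) i j l n y = curvForm k 0 (spaceMetric k ψ y) 0 i j l n := by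
  have hdet := (hψ.roundMetric_posDef hU).det_pos.ne'
  have hd : deriv (fun r : ℝ => 1 / (1 - k * r ^ 2)) (y (Sum.inl ()))
      = 2 * k * y (Sum.inl ()) / (1 - k * y (Sum.inl ()) ^ 2) ^ 2 := by
    have h1 : HasDerivAt (fun r : ℝ => 1 - k * r ^ 2) (-(k * (2 * y (Sum.inl ()))))
        (y (Sum.inl ())) := by
      simpa using ((hasDerivAt_pow 2 (y (Sum.inl ()))).const_mul k).const_sub 1
    simp only [one_div]
    rw [(h1.fun_inv hk.ne').deriv]
    ring
  rw [spaceMetric, riemannLow_warp (K := 1) (α := k) (β := 0) (roundMetric_isSymm ψ)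
    (contDiffAt_one_div_one_sub hk) contDiffAt_id (hψ.roundMetric_contDiffAt hU)
    (one_div_pos.2 hk).ne' hr.ne' hdet]
  · simp [curvForm]
  · intro a b c d
    rw [hψ.riemannLow_roundMetric hU]
    simp [curvForm]
  · have h1 := hk.ne'
    have h2 := hr.ne'
    simp only [deriv_id, id]
    field_simp
    ring
  · have h1 := hk.ne'
    have h2 := hr.ne'
    simp only [hd, deriv_id', deriv_id, deriv_const, id]
    field_simp
    ring

end Space

end FLRW

/-! ### Curvature invariants as polynomials in `R` and `Γ`. -/

section FrameContraction

variable {ι : Type*} [Fintype ι] [DecidableEq ι] {n : ℕ}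

theorem contraction_eq_of_frame {g : (ι → ℝ) → Matrix ι ι ℝ} {x : ι → ℝ} {α β : ℝ}
    {q q₀ : Matrix ι ι ℝ} {E : Matrix ι ι ℂ} (hd : (g x).det ≠ 0)
    (hR : ∀ a b c d, riemannLow g a b c d x = curvForm α β (g x) q a b c d)
    (hE : E * E.transpose = (g x).map Complex.ofRealHom)
    (hq : E * q₀.map Complex.ofRealHom * E.transpose = q.map Complex.ofRealHom) (e : Pattern n) :
    contraction e g x = fullContraction e (fun _ => curvTensor α β 1 q₀) 1 := by
  have hcurv : ∀ (X Y : Matrix ι ι ℝ) (u : Fin 4 → ι),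
      Complex.ofRealHom (curvTensor α β X Y u) = curvTensor (α : ℂ) (β : ℂ)
        (X.map Complex.ofRealHom) (Y.map Complex.ofRealHom) u := fun X Y u => by
    simp [curvTensor, curvForm]
  have h1 : contraction e g x
      = fullContraction e (fun _ => curvTensor α β (g x) q) (g x)⁻¹ := by
    simp only [contraction, hR]
    rfl
  have hinv : E.transpose * (g x)⁻¹.map Complex.ofRealHom * E = 1 := by
    have h2 : (g x)⁻¹.map Complex.ofRealHom * (g x).map Complex.ofRealHom = 1 := by
      rw [← Matrix.map_mul, Matrix.nonsing_inv_mul _ (isUnit_iff_ne_zero.2 hd),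
        Matrix.map_one _ (map_zero _) (map_one _)]
    rw [← hE, ← Matrix.mul_assoc] at h2
    rw [Matrix.mul_assoc]
    exact mul_eq_one_comm.1 h2
  -- Both sides are real, but the frame is complex, so the comparison takes place in `ℂ`.
  refine Complex.ofReal_injective ?_
  change Complex.ofRealHom _ = Complex.ofRealHom _
  rw [h1, map_fullContraction, map_fullContraction,
    Matrix.map_one _ (map_zero _) (map_one _), ← hinv, ← fullContraction_frame]
  congr 1
  funext _ u
  rw [hcurv, ← hE, ← hq, curvTensor_frame]
  simp only [hcurv, Matrix.map_one _ (map_zero Complex.ofRealHom) (map_one _)]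

/-- The complete contraction along `e` in an orthonormal frame that takes the trace-free Ricci part
of the curvature in the factors of `S` and the scalar part in the others; `z` holds the eigenvalues
of the trace-free Ricci tensor. -/
noncomputable def contractionCoeff (z : ι → ℝ) (e : Pattern n) (S : Finset (Fin n)) : ℝ :=
  fullContraction e (fun i => if i ∈ S then
      curvTensor 0 (1 / ((Fintype.card ι : ℝ) - 2)) 1 (Matrix.diagonal z)
    else curvTensor (1 / ((Fintype.card ι : ℝ) * ((Fintype.card ι : ℝ) - 1))) 0 1 0) 1

theorem contractionCoeff_eq_zero {z : ι → ℝ} (hz : ∑ a, z a = 0) (e : Pattern n)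
    {S : Finset (Fin n)} (hS : S.card = 1) : contractionCoeff z e S = 0 := by
  obtain ⟨i, rfl⟩ := Finset.card_eq_one.1 hS
  rw [← fullContraction_linear_eq_zero e i
    (1 / ((Fintype.card ι : ℝ) * ((Fintype.card ι : ℝ) - 1))) (1 / ((Fintype.card ι : ℝ) - 2)) z hz]
  rw [contractionCoeff]
  congr 1
  funext j
  by_cases hj : j = i
  · subst hj
    simp
  · simp [hj]

/-- Replacing `α`, `β` by `R`, `Γ` splits the curvature into its scalar and trace-free Ricci parts.
In the frame, both parts are constant tensors multiplied by `R` and `Γ`. -/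
theorem contraction_eq_sum {g : (ι → ℝ) → Matrix ι ι ℝ} {x : ι → ℝ} {α β : ℝ}
    {q : Matrix ι ι ℝ} {w : ι → ℝ} {E : Matrix ι ι ℂ} (hs : ∀ y, (g y).IsSymm)
    (hd : (g x).det ≠ 0) (hD : 2 < Fintype.card ι) (htr : (q * (g x)⁻¹).trace = -1)
    (hR : ∀ a b c d, riemannLow g a b c d x = curvForm α β (g x) q a b c d)
    (hE : E * E.transpose = (g x).map Complex.ofRealHom)
    (hq : E * (Matrix.diagonal w).map Complex.ofRealHom * E.transpose = q.map Complex.ofRealHom)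
    {Γ : ℝ} (hΓ : Γ = β * (Fintype.card ι - 2) / Fintype.card ι) (e : Pattern n) :
    contraction e g x = ∑ S : Finset (Fin n), Γ ^ S.card * scalarCurv g x ^ (n - S.card)
      * contractionCoeff (fun a => 1 + Fintype.card ι * w a) e S := by
  have hD' : (2 : ℝ) < Fintype.card ι := by exact_mod_cast hD
  have h0 : (Fintype.card ι : ℝ) ≠ 0 := by linarith
  have h1 : (Fintype.card ι : ℝ) - 1 ≠ 0 := by linarith
  have h2 : (Fintype.card ι : ℝ) - 2 ≠ 0 := by linarith
  rw [contraction_eq_of_frame hd hR hE hq]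
  simp only [contractionCoeff]
  rw [← fullContraction_smul_add]
  congr 1
  funext _ u
  have hdiag : ∀ a b, Matrix.diagonal (fun a => 1 + Fintype.card ι * w a) a b
      = (1 : Matrix ι ι ℝ) a b + Fintype.card ι * Matrix.diagonal w a b := fun a b => by
    by_cases h : a = b
    · subst h
      simp
    · simp [h]
  simp only [curvTensor, curvForm, hdiag, scalarCurv_of_curvForm hs hd htr hR, hΓ]
  generalize (1 : Matrix ι ι ℝ) = J
  simp only [Matrix.zero_apply]
  field_simp
  ring

/-- A linear combination of curvature invariants as a polynomial in `R` and `Γ`. -/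
theorem curvInvariant_eq_sum {g : (ι → ℝ) → Matrix ι ι ℝ} {x : ι → ℝ} {Γ : ℝ} {z : ι → ℝ}
    (h : ∀ e : Pattern n, contraction e g x = ∑ S : Finset (Fin n),
      Γ ^ S.card * scalarCurv g x ^ (n - S.card) * contractionCoeff z e S) (c : Pattern n → ℝ) :
    curvInvariant c g x = ∑ j : Fin (n + 1),
      (∑ e, c e * ∑ S : Finset (Fin n) with S.card = (j : ℕ), contractionCoeff z e S)
        * scalarCurv g x ^ (n - (j : ℕ)) * Γ ^ (j : ℕ) := by
  simp only [curvInvariant, h, Finset.sum_mul]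
  rw [Finset.sum_comm]
  refine Finset.sum_congr rfl fun e _ => ?_
  -- A term depends on `S` through the powers only by its cardinality, so subsets are grouped by
  -- size.
  rw [Finset.mul_sum, ← Finset.sum_fiberwise Finset.univ
    (fun S : Finset (Fin n) => (⟨S.card, Nat.lt_succ_of_le (card_finset_fin_le S)⟩ : Fin (n + 1)))]
  refine Finset.sum_congr rfl fun j _ => ?_
  rw [Finset.mul_sum, Finset.sum_mul, Finset.sum_mul]
  refine Finset.sum_congr (Finset.filter_congr fun S _ => by rw [Fin.ext_iff]) fun S hS => ?_
  rw [(Finset.mem_filter.1 hS).2]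
  ring

end FrameContraction

/-! ### Curvature and frame of the FLRW metric. -/

section FLRWCurvature

/-- The tensor `F dt²`. -/
def timeForm {κ : Type*} (F : ℝ) : Matrix (Unit ⊕ κ) (Unit ⊕ κ) ℝ :=
  Matrix.fromBlocks (Matrix.of fun _ _ => F) 0 0 0

theorem timeForm_isSymm {κ : Type*} (F : ℝ) : (timeForm F : Matrix (Unit ⊕ κ) _ ℝ).IsSymm := by
  rw [timeForm, Matrix.isSymm_fromBlocks_iff]
  exact ⟨by ext; simp, by simp, by simp, by simp⟩

theorem timeForm_mul_warp_inv {κ : Type*} [Fintype κ] [DecidableEq κ] {N b : ℝ → ℝ}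
    {h : (κ → ℝ) → Matrix κ κ ℝ} {x : Unit ⊕ κ → ℝ} (hN : N (x (Sum.inl ())) ≠ 0)
    (hb : b (x (Sum.inl ())) ≠ 0) (hd : (h fun i => x (Sum.inr i)).det ≠ 0) :
    timeForm (-N (x (Sum.inl ()))) * (warp N b h x)⁻¹
      = Matrix.fromBlocks (-1 : Matrix Unit Unit ℝ) 0 0 0 := by
  rw [warp_inv hN hb hd, timeForm, Matrix.fromBlocks_multiply]
  congr 1
  · ext
    simp [Matrix.mul_apply, hN]
  · simp
  · simp
  · simp

variable {m : ℕ} {k : ℝ} {a F : ℝ → ℝ}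
  {ψ : (Fin m → ℝ) → EuclideanSpace ℝ (Fin (m + 1))} {U : Set (Fin m → ℝ)} {x : Idx m → ℝ}

theorem flrwMetric_isSymm (k : ℝ) (a F : ℝ → ℝ)
    (ψ : (Fin m → ℝ) → EuclideanSpace ℝ (Fin (m + 1))) (x : Idx m → ℝ) :
    (flrwMetric k a F ψ x).IsSymm := by
  rw [flrwMetric_eq_warp]
  exact warp_isSymm (spaceMetric_isSymm k ψ) x

theorem flrwMetric_det (hψ : IsSphereParam ψ U) (ha0 : 0 < a (tOf x)) (hF0 : 0 < F (tOf x))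
    (hr : 0 < rOf x) (hk : 0 < 1 - k * rOf x ^ 2) (hU : angOf x ∈ U) :
    (flrwMetric k a F ψ x).det ≠ 0 := by
  rw [flrwMetric_eq_warp, warp_det]
  exact mul_ne_zero (neg_ne_zero.2 hF0.ne')
    (mul_ne_zero (pow_ne_zero _ (pow_ne_zero _ ha0.ne')) (spaceMetric_det hψ hr hk hU))

theorem timeForm_mul_flrwMetric_inv (hψ : IsSphereParam ψ U) (ha0 : 0 < a (tOf x))
    (hF0 : 0 < F (tOf x)) (hr : 0 < rOf x) (hk : 0 < 1 - k * rOf x ^ 2) (hU : angOf x ∈ U) :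
    timeForm (F (tOf x)) * (flrwMetric k a F ψ x)⁻¹
      = Matrix.fromBlocks (-1 : Matrix Unit Unit ℝ) 0 0 0 := by
  rw [flrwMetric_eq_warp]
  have h := timeForm_mul_warp_inv (N := fun t => -F t) (b := a) (h := spaceMetric k ψ) (x := x)
    (neg_ne_zero.2 hF0.ne') ha0.ne' (spaceMetric_det hψ hr hk hU)
  simp only [neg_neg] at h
  exact h

/-- Second use of `riemannLow_warp`, with `N = -F`, `b = a` and fibre curvature `k`. The values of
`α` and `β` can stay hidden: later steps need only the relation of `β` to `Γ`. -/
theorem exists_riemannLow_flrwMetric (hψ : IsSphereParam ψ U) (ha : ContDiffAt ℝ 2 a (tOf x))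
    (hF : ContDiffAt ℝ 2 F (tOf x)) (ha0 : 0 < a (tOf x)) (hF0 : 0 < F (tOf x))
    (hr : 0 < rOf x) (hk : 0 < 1 - k * rOf x ^ 2) (hU : angOf x ∈ U) :
    ∃ α β : ℝ, (∀ p q r s, riemannLow (flrwMetric k a F ψ) p q r s x
        = curvForm α β (flrwMetric k a F ψ x) (timeForm (F (tOf x))) p q r s) ∧
      flrwGamma (m + 2) k a F (tOf x)
        = β * (Fintype.card (Idx m) - 2) / Fintype.card (Idx m) := by
  have hcard : (Fintype.card (Idx m) : ℝ) = m + 2 := by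
    simp [Idx]
    ring
  have h := riemannLow_warp (x := x) (N := fun t => -F t) (b := a) (h := spaceMetric k ψ) (K := k)
    (spaceMetric_isSymm k ψ) hF.neg ha (spaceMetric_contDiffAt hψ hk hU)
    (neg_ne_zero.2 hF0.ne') ha0.ne' (spaceMetric_det hψ hr hk hU)
    (riemannLow_spaceMetric hψ hr hk hU) rfl rfl
  simp only [neg_neg] at h
  rw [← flrwMetric_eq_warp] at h
  refine ⟨_, _, h, ?_⟩
  have h1 : F (x (Sum.inl ())) ≠ 0 := hF0.ne'
  have h2 : a (x (Sum.inl ())) ≠ 0 := ha0.ne'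
  have h3 : (m : ℝ) + 2 ≠ 0 := by positivity
  rw [hcard, flrwGamma]
  simp only [deriv.fun_neg, tOf]
  push_cast
  field_simp
  ring

/-- The eigenvalues of `F dt²` with respect to the metric. -/
def timeEigenvalue {κ : Type*} : Unit ⊕ κ → ℝ := Sum.elim (fun _ => -1) fun _ => 0

theorem exists_frame_flrwMetric (hψ : IsSphereParam ψ U) (hF0 : 0 < F (tOf x))
    (hk : 0 < 1 - k * rOf x ^ 2) (hU : angOf x ∈ U) :
    ∃ E : Matrix (Idx m) (Idx m) ℂ,
      E * E.transpose = (flrwMetric k a F ψ x).map Complex.ofRealHom ∧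
      E * (Matrix.diagonal timeEigenvalue).map Complex.ofRealHom * E.transpose
        = (timeForm (F (tOf x))).map Complex.ofRealHom := by
  obtain ⟨Q, hQ⟩ := exists_eq_mul_transpose_of_posSemidef (hψ.roundMetric_posDef hU).posSemidef
  have h1 : Q.map Complex.ofReal * (Q.map Complex.ofReal).transpose
      = (roundMetric ψ (angOf x)).map Complex.ofReal := by
    rw [hQ]
    exact (Matrix.map_mul (f := Complex.ofRealHom)).symm
  have h2 : ((√(1 / (1 - k * rOf x ^ 2)) : ℝ) : ℂ) * (√(1 / (1 - k * rOf x ^ 2)) : ℝ)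
      = ((1 / (1 - k * rOf x ^ 2) : ℝ) : ℂ) := by
    rw [← Complex.ofReal_mul, Real.mul_self_sqrt (one_div_pos.2 hk).le]
  -- The time leg of the frame is `i √F`, whose square is the negative entry `-F`.
  have h3 : Complex.I * (√(F (tOf x)) : ℝ) * (Complex.I * (√(F (tOf x)) : ℝ))
      = ((-F (tOf x) : ℝ) : ℂ) := by
    rw [mul_mul_mul_comm, Complex.I_mul_I, ← Complex.ofReal_mul, Real.mul_self_sqrt hF0.le]
    simp
  have h4 := warp_map_eq_mul_transpose (N := fun r => 1 / (1 - k * r ^ 2)) (b := id)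
    (h := roundMetric ψ) (x := fun i => x (Sum.inr i)) h2 h1
  have h5 := warp_map_eq_mul_transpose (N := fun t => -F t) (b := a)
    (h := spaceMetric k ψ) (x := x) h3 h4
  refine ⟨_, h5.trans (by rw [flrwMetric_eq_warp]; rfl), ?_⟩
  have hdiag : (Matrix.diagonal (timeEigenvalue : Idx m → ℝ)).map Complex.ofRealHom
      = Matrix.fromBlocks (-1 : Matrix Unit Unit ℂ) 0 0 0 := by
    ext i j
    rcases i with i | i <;> rcases j with j | j <;>
      simp [timeEigenvalue, Matrix.diagonal_apply]
  rw [hdiag, Matrix.fromBlocks_transpose, Matrix.fromBlocks_multiply, Matrix.fromBlocks_multiply,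
    timeForm, Matrix.fromBlocks_map]
  congr 1
  · ext
    have h6 := congr_arg Neg.neg h3
    simpa [Matrix.mul_apply] using h6
  · ext; simp
  · ext; simp
  · ext; simp

end FLRWCurvature

end Curv

/-! ### Assembly of the theorem. -/

/-- In dimension `D ≥ 3`, every linear combination of curvature invariants of order `n` is, on all
FLRW metrics, one and the same linear combination of products `R^b₁ K₂^b₂ K₃^b₃` with
`b₁ + 2 b₂ + 3 b₃ = n`; moreover `K₂ = Γ²` and `K₃ = Γ³` there. -/
theorem mainTheorem5 (D : ℕ) (hD : 3 ≤ D) (n : ℕ) (c : Curv.Pattern n → ℝ) :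
    ∃ (p : ℕ) (β : Fin p → ℝ) (b₁ b₂ b₃ : Fin p → ℕ),
      (∀ i, b₁ i + 2 * b₂ i + 3 * b₃ i = n) ∧
      ∀ (k : ℝ), (k = -1 ∨ k = 0 ∨ k = 1) →
      ∀ (I : Set ℝ) (a F : ℝ → ℝ), IsOpen I →
        ContDiffOn ℝ 2 a I → ContDiffOn ℝ 2 F I →
        (∀ t ∈ I, 0 < a t) → (∀ t ∈ I, 0 < F t) →
      ∀ (U : Set (Fin (D - 2) → ℝ))
        (ψ : (Fin (D - 2) → ℝ) → EuclideanSpace ℝ (Fin (D - 2 + 1))),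
        Curv.IsSphereParam ψ U →
      ∀ x : Curv.Idx (D - 2) → ℝ,
        Curv.tOf x ∈ I → 0 < Curv.rOf x → 0 < 1 - k * Curv.rOf x ^ 2 → Curv.angOf x ∈ U →
        Curv.curvInvariant c (Curv.flrwMetric k a F ψ) x
            = ∑ i, β i * Curv.scalarCurv (Curv.flrwMetric k a F ψ) x ^ b₁ i
                * Curv.K2 (Curv.flrwMetric k a F ψ) x ^ b₂ i
                * Curv.K3 (Curv.flrwMetric k a F ψ) x ^ b₃ i
          ∧ Curv.K2 (Curv.flrwMetric k a F ψ) x = Curv.flrwGamma D k a F (Curv.tOf x) ^ 2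
          ∧ Curv.K3 (Curv.flrwMetric k a F ψ) x = Curv.flrwGamma D k a F (Curv.tOf x) ^ 3 := by
  have hD2 : D - 2 + 2 = D := by omega
  have hcard : Fintype.card (Curv.Idx (D - 2)) = D := by
    simp only [Curv.Idx, Fintype.card_sum, Fintype.card_unit, Fintype.card_fin]
    omega
  set z : Curv.Idx (D - 2) → ℝ :=
    fun i => 1 + (Fintype.card (Curv.Idx (D - 2)) : ℝ) * Curv.timeEigenvalue i with hzdef
  -- The values are `1 - D` once and `1` for the other `D - 1` indices.
  have hz : ∑ i, z i = 0 := by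
    rw [Finset.sum_add_distrib, ← Finset.mul_sum, Fintype.sum_sum_type]
    simp [Curv.timeEigenvalue]
    ring
  -- The index `j` is the power of `Γ`: even `j` uses `K₂^(j/2)`, odd `j ≥ 3` uses `K₂^((j-3)/2)
  -- K₃`. For `j = 1` the coefficient is zero, and the exponents `(n, 0, 0)` only serve to meet the
  -- degree condition.
  refine ⟨n + 1, fun j => ∑ e, c e * ∑ S : Finset (Fin n) with S.card = (j : ℕ),
      Curv.contractionCoeff z e S,
    fun j => if (j : ℕ) = 1 then n else n - j,
    fun j => if (j : ℕ) = 1 then 0 else if (j : ℕ) % 2 = 0 then j / 2 else (j - 3) / 2,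
    fun j => if (j : ℕ) = 1 then 0 else j % 2, ?_, ?_⟩
  · intro j
    have := j.2
    dsimp only
    split_ifs <;> omega
  intro k _ I a F hI ha hF ha0 hF0 U ψ hψ x ht hr hk hU
  have hat := ha.contDiffAt (hI.mem_nhds ht)
  have hFt := hF.contDiffAt (hI.mem_nhds ht)
  obtain ⟨α, β, hR, hΓ⟩ :=
    Curv.exists_riemannLow_flrwMetric hψ hat hFt (ha0 _ ht) (hF0 _ ht) hr hk hU
  rw [hD2] at hΓ
  have hs := Curv.flrwMetric_isSymm k a F ψ
  have hdet := Curv.flrwMetric_det hψ (ha0 _ ht) (hF0 _ ht) hr hk hU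
  have hP := Curv.timeForm_mul_flrwMetric_inv hψ (ha0 _ ht) (hF0 _ ht) hr hk hU
  have htr : (Curv.timeForm (F (Curv.tOf x)) * (Curv.flrwMetric k a F ψ x)⁻¹).trace = -1 := by
    rw [hP, Matrix.trace, Fintype.sum_sum_type]
    simp
  have hPP : Curv.timeForm (F (Curv.tOf x)) * (Curv.flrwMetric k a F ψ x)⁻¹
      * (Curv.timeForm (F (Curv.tOf x)) * (Curv.flrwMetric k a F ψ x)⁻¹)
      = -(Curv.timeForm (F (Curv.tOf x)) * (Curv.flrwMetric k a F ψ x)⁻¹) := by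
    rw [hP, Matrix.fromBlocks_multiply, Matrix.fromBlocks_neg]
    simp
  have hc2 : 2 < Fintype.card (Curv.Idx (D - 2)) := by rw [hcard]; omega
  have hK2 := Curv.K2_of_curvForm hs hdet hc2 (Curv.timeForm_isSymm _) htr hPP hR hΓ
  have hK3 := Curv.K3_of_curvForm hs hdet hc2 htr hPP hR hΓ
  obtain ⟨E, hE, hEq⟩ := Curv.exists_frame_flrwMetric (a := a) hψ (hF0 _ ht) hk hU
  refine ⟨?_, hK2, hK3⟩
  rw [Curv.curvInvariant_eq_sum (Curv.contraction_eq_sum hs hdet hc2 htr hR hE hEq hΓ) c, hK2, hK3]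
  refine Finset.sum_congr rfl fun j _ => ?_
  dsimp only
  by_cases hj : (j : ℕ) = 1
  -- The power `Γ¹` is not a product of `Γ²` and `Γ³`; its coefficient vanishes by trace-freeness.
  · have h0 : ∀ e, ∑ S : Finset (Fin n) with S.card = (j : ℕ), Curv.contractionCoeff z e S = 0 :=
      fun e => Finset.sum_eq_zero fun S hS =>
        Curv.contractionCoeff_eq_zero hz e ((Finset.mem_filter.1 hS).2.trans hj)
    simp only [← hzdef, h0]
    simp
  · rw [if_neg hj, if_neg hj, if_neg hj, mul_assoc, mul_assoc, mul_assoc, ← pow_mul, ← pow_mul,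
      ← pow_add]
    congr 3
    split_ifs <;> omega
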